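/- Let $n\ge 3$. Let $\binom{[n]}2$ be the set of edges $\{i,j\}$ of the complete graph on the vertices of the $n$-gon (labelled in cyclic order, indices modulo $n$). An edge is a diagonal (relevant) if its end-points are not cyclically consecutive; two edges cross if their end-points are four different points that alternate along the polygon. For $w\in\mathbb R^{\binom{[n]}2}$ let $d(w)\in\mathbb R^{\binom{[n]}2}$, $d_{a,b}(w)=\sum_{a\le i<b\le j<a}w_{ij}$ (cyclic inequalities, each edge $\{i,j\}$ counted once), and let $W_{ij}=d(e_{ij})$ be the image of the standard basis vector $e_{ij}$. Let $\mathrm{FP}_n=\operatorname{Grob}_1(n)$ be the cone of all $v\in\mathbb R^{\binom{[n]}2}$ with $v_{a,b}+v_{a',b'}\ge\max\{v_{a,a'}+v_{b,b'},\,v_{a,b'}+v_{a',b}\}$ for all $a<a'<b<b'$. Let $\mathcal V_1(n)$ be the set of all $v$ such that, for all $a<a'<b<b'$, the maximum of the three numbers $v_{a,b}+v_{a',b'}$, $v_{a,a'}+v_{b,b'}$, $v_{a,b'}+v_{a',b}$ is attained at least twice. Let $\mathcal V^+_1(n)=\mathcal V_1(n)\cap\mathrm{FP}_n$, a fan whose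 cones are the faces of $\mathrm{FP}_n$ contained in $\mathcal V_1(n)$; it is the union of these cones. Let $L_n$ be the span of the vectors $W_{ij}$ over the edges $\{i,j\}$ that are not diagonals. Let $T$ be a triangulation of the $n$-gon (a maximal set of pairwise non-crossing edges) and $\overline T$ its set of diagonals. Let $\pi:\mathbb R^{\binom{[n]}2}\to\mathbb R^T$ be the coordinate projection and let $\phi:\mathbb R^T\to\mathbb R^{\overline T}$ be a surjective linear map with kernel $\pi(L_n)$. Then $|\overline T|=n-3$ and such maps $\phi$ exist. For each such $\phi$, put $\overline W_{ij}=\phi(\pi(W_{ij}))$, $b_{ij}=(j-i)(n+i-j)$ for $i<j$, and $$P=\{X\in\mathbb R^{\overline T}:\ \langle\overline W_{ij},X\rangle\le b_{ij}\ \text{ for every diagonal } \{i,j\}\}.$$ Then: 1. For $v,v'\in\mathcal V_1^+(n)$ one has $\phi\pi(v)=\phi\pi(v')$ if and only if $v-v'\in L_n$. 2. $P$ is a full-dimensional polytope that realizes the $(n-3)$-associahedron: $G\mapsto P_G=\{X\in P:\langle\overline W_{ij},X\rangle=b_{ij}\ \forall\{i,j\}\in G\}$ is a bijection from the non-crossing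 sets of diagonals to the nonempty faces of $P$, with $P_{G'}\subseteq P_G$ if and only if $G\subseteq G'$. In particular the facets of $P$ are $P_{\{e\}}$ for the diagonals $e$. 3. The images under $\phi\circ\pi$ of the cones of $\mathcal V_1^+(n)$ are exactly the cones of the (outer) normal fan of $P$. More precisely, for each non-crossing set $G$ of diagonals the normal cone of $P_G$ is the image of $\{d(w): w_e\ge0 \text{ for all diagonals } e,\ w_e=0\text{ for all diagonals } e\notin G\}$. So $P_{\{e\}}$ has outer normal $\overline W_e$. 4. The right-hand sides $b_{ij}$ satisfy the wall-crossing inequalities: if the triangulations $T_1,T_2$ differ by exchanging a diagonal $e_1$ for a diagonal $e_2$, and $\sum_e\omega_e\overline W_e=0$ (sum over the diagonals of $T_1\cup T_2$) with $\omega_{e_1},\omega_{e_2}>0$, then $\sum_e\omega_eb_e>0$. 5. $P$ has exactly $n-3$ pairs of parallel facets (that is, pairs of different facets with proportional normals). They are the pairs that consist of the facet of a diagonal $\{a,b\}\in\overline T$ and the facet of its rotation $\{a-1,b-1\}$, and $\overline W_{a-1,b-1}=-\overline W_{a,b}$; different diagonals of $T$ give different pairs. 6. The vectors $\overline W_\delta$,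 $\delta\in\overline T$, form a basis of $\mathbb R^{\overline T}$, and in this basis $\overline W_e$ has all its coordinates in $\{0,1,-1\}$ for every diagonal $e$. -/

import Mathlib

namespace Assoc

/-! Vertices of the `n`-gon are the elements of `Fin n`, in cyclic order. -/

/-- Edges of the complete graph on the vertices of the `n`-gon, each written as an increasing pair. -/
abbrev Edge (n : ℕ) := {p : Fin n × Fin n // p.1 < p.2}

/-- The edge joining two different vertices. -/
def Edge.mk {n : ℕ} (a b : Fin n) (h : a ≠ b) : Edge n :=
  ⟨(min a b, max a b), min_lt_max.2 h⟩

/-- Two edges cross if their end-points are distinct and alternate along the polygon. -/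
def Crosses {n : ℕ} (e f : Edge n) : Prop :=
  (e.1.1 < f.1.1 ∧ f.1.1 < e.1.2 ∧ e.1.2 < f.1.2) ∨
  (f.1.1 < e.1.1 ∧ e.1.1 < f.1.2 ∧ f.1.2 < e.1.2)

/-- The diagonals of the polygon (relevant edges): the end-points are not cyclically consecutive. -/
def Relevant {n : ℕ} (e : Edge n) : Prop :=
  (e.1.1 : ℕ) + 1 < (e.1.2 : ℕ) ∧ (e.1.2 : ℕ) + 1 < (e.1.1 : ℕ) + n

instance {n : ℕ} : DecidablePred (Relevant (n := n)) := fun e => by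
  unfold Relevant; infer_instance

/-- The rotated edge `{a - 1, b - 1}` (indices modulo `n`) of an edge `{a, b}`. -/
def Edge.rotate {n : ℕ} (e : Edge n) : Edge n :=
  Edge.mk ((finRotate n).symm e.1.1) ((finRotate n).symm e.1.2)
    (fun h => e.2.ne ((finRotate n).symm.injective h))

/-- A set of edges without crossings. -/
def NonCrossing {n : ℕ} (G : Finset (Edge n)) : Prop :=
  ∀ e ∈ G, ∀ f ∈ G, ¬ Crosses e f

/-- Triangulations: maximal non-crossing sets of edges (they contain all sides of the polygon). -/
def IsTriangulation {n : ℕ} (T : Finset (Edge n)) : Prop :=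
  Maximal NonCrossing T

/-- The relevant part of a set of edges. -/
def diagonals {n : ℕ} (T : Finset (Edge n)) : Finset (Edge n) :=
  T.filter Relevant

/-- The faces of the simplicial associahedron: non-crossing sets of diagonals. -/
def reducedComplex (n : ℕ) : Set (Finset (Edge n)) :=
  {G | NonCrossing G ∧ ∀ e ∈ G, Relevant e}

/-! ### Weight vectors -/

/-- Four-point positive vectors: the weights for which the crossing monomial is a leading one
in every Pfaffian of degree two. This is the Groebner cone for `k = 1`. -/
def FP (n : ℕ) : Set (Edge n → ℝ) :=
  {v | ∀ (a a' b b' : Fin n) (h₁ : a < a') (h₂ : a' < b) (h₃ : b < b'),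
    max (v ⟨(a, a'), h₁⟩ + v ⟨(b, b'), h₃⟩)
        (v ⟨(a, b'), h₁.trans (h₂.trans h₃)⟩ + v ⟨(a', b), h₂⟩)
      ≤ v ⟨(a, b), h₁.trans h₂⟩ + v ⟨(a', b'), h₂.trans h₃⟩}

/-- The maximum of three numbers is attained at least twice. -/
def MaxAttainedTwice (x y z : ℝ) : Prop :=
  (x = y ∧ z ≤ x) ∨ (x = z ∧ y ≤ x) ∨ (y = z ∧ x ≤ y)

/-- The tropical Pfaffian prevariety for `k = 1`: for any four points, the maximum weight of the
three perfect matchings among them is attained at least twice. -/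
def PV (n : ℕ) : Set (Edge n → ℝ) :=
  {v | ∀ (a a' b b' : Fin n) (h₁ : a < a') (h₂ : a' < b) (h₃ : b < b'),
    MaxAttainedTwice
      (v ⟨(a, b), h₁.trans h₂⟩ + v ⟨(a', b'), h₂.trans h₃⟩)
      (v ⟨(a, a'), h₁⟩ + v ⟨(b, b'), h₃⟩)
      (v ⟨(a, b'), h₁.trans (h₂.trans h₃)⟩ + v ⟨(a', b), h₂⟩)}

/-- The part of the prevariety contained in the Groebner cone, for `k = 1`. -/
def PVplus (n : ℕ) : Set (Edge n → ℝ) := PV n ∩ FP n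

/-- The cones of `PVplus n`: the faces of the polyhedral cone `FP n` that it contains. -/
def fanPVplus (n : ℕ) : Set (Set (Edge n → ℝ)) :=
  {F | F.Nonempty ∧ IsExposed ℝ (FP n) F ∧ F ⊆ PVplus n}

/-- The edge `e` between vertices separates the sides `a = {a - 1, a}` and `b = {b - 1, b}` of the
polygon, where `s = {a, b}`: exactly one end-point of `e` lies in the cyclic interval `[a, b)`. -/
def Separates {n : ℕ} (e s : Edge n) : Prop :=
  Xor (s.1.1 ≤ e.1.1 ∧ e.1.1 < s.1.2) (s.1.1 ≤ e.1.2 ∧ e.1.2 < s.1.2)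

open scoped Classical in
/-- The separation vector `d(w)`, as a linear map in `w`: its coordinate at `{a, b}` is the sum of
`w i j` over the edges `{i, j}` with `a ≤ i < b ≤ j < a` cyclically. -/
noncomputable def sepVec (n : ℕ) : (Edge n → ℝ) →ₗ[ℝ] (Edge n → ℝ) where
  toFun w s := ∑ e : Edge n, if Separates e s then w e else 0
  map_add' w w' := by
    funext s
    simp only [Pi.add_apply, ← Finset.sum_add_distrib]
    exact Finset.sum_congr rfl fun e _ => by split_ifs <;> simp
  map_smul' c w := by
    funext s
    simp only [Pi.smul_apply, smul_eq_mul, RingHom.id_apply, Finset.mul_sum]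
    exact Finset.sum_congr rfl fun e _ => by split_ifs <;> simp

/-- The generator of `PVplus n` that corresponds to the edge `e`. -/
noncomputable def ray {n : ℕ} (e : Edge n) : Edge n → ℝ :=
  sepVec n (Pi.single e 1)

/-- The irrelevant face: the span of the generators of the sides of the polygon. -/
noncomputable def irrelevantSpace (n : ℕ) : Submodule ℝ (Edge n → ℝ) :=
  Submodule.span ℝ {v | ∃ e : Edge n, ¬ Relevant e ∧ v = ray e}

/-- The face of `FP n` that corresponds to the set `G` of diagonals. -/
def coneOf {n : ℕ} (G : Finset (Edge n)) : Set (Edge n → ℝ) :=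
  {v | ∃ w : Edge n → ℝ, (∀ e, Relevant e → 0 ≤ w e) ∧
    (∀ e, Relevant e → e ∉ G → w e = 0) ∧ v = sepVec n w}

/-! ### Projections given by a seed triangulation -/

/-- Restriction of a vector to the coordinates in `T`. -/
def restrict {n : ℕ} (T : Finset (Edge n)) : (Edge n → ℝ) →ₗ[ℝ] (T → ℝ) :=
  LinearMap.funLeft ℝ ℝ (Subtype.val : T → Edge n)

/-- `φ` is the further projection to a space of dimension the number of diagonals of `T`:
it collapses exactly the image of the irrelevant face. -/
def IsReduction {n : ℕ} (T : Finset (Edge n))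
    (φ : (T → ℝ) →ₗ[ℝ] (diagonals T → ℝ)) : Prop :=
  Function.Surjective φ ∧
    LinearMap.ker φ = Submodule.map (restrict T) (irrelevantSpace n)

/-- The two projections one after the other. -/
def proj {n : ℕ} (T : Finset (Edge n)) (φ : (T → ℝ) →ₗ[ℝ] (diagonals T → ℝ)) :
    (Edge n → ℝ) →ₗ[ℝ] (diagonals T → ℝ) :=
  φ ∘ₗ restrict T

/-- The projection of the fan `PVplus n`, as a collection of cones. -/
def projectedFan {n : ℕ} (T : Finset (Edge n)) (φ : (T → ℝ) →ₗ[ℝ] (diagonals T → ℝ)) :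
    Set (Set (diagonals T → ℝ)) :=
  {C | ∃ F ∈ fanPVplus n, C = proj T φ '' F}

/-! ### Polytopes and normal fans -/

section Polytopes

variable {ι : Type*} [Fintype ι]

/-- A polytope is the convex hull of a finite set. -/
def IsPolytope (P : Set (ι → ℝ)) : Prop :=
  ∃ S : Finset (ι → ℝ), P = convexHull ℝ (S : Set (ι → ℝ))

/-- Nonempty faces of a polytope, including the polytope itself. -/
def faces (P : Set (ι → ℝ)) : Set (Set (ι → ℝ)) :=
  {F | F.Nonempty ∧ IsExposed ℝ P F}

/-- The (outer) normal cone of a face. -/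
def normalCone (P F : Set (ι → ℝ)) : Set (ι → ℝ) :=
  {c | ∀ x ∈ F, ∀ y ∈ P, dotProduct c y ≤ dotProduct c x}

/-- The normal fan of a polytope, as a collection of cones. -/
def normalFan (P : Set (ι → ℝ)) : Set (Set (ι → ℝ)) :=
  {C | ∃ F ∈ faces P, C = normalCone P F}

/-- The polyhedron with one inequality `⟨N e, X⟩ ≤ b e` for each diagonal `e` of the `n`-gon. -/
def polyhedron {n : ℕ} (N : Edge n → ι → ℝ) (b : Edge n → ℝ) : Set (ι → ℝ) :=
  {X | ∀ e, Relevant e → dotProduct (N e) X ≤ b e}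

/-- The points of the polyhedron where the inequalities of all the edges in `G` are equalities. -/
def faceOf {n : ℕ} (N : Edge n → ι → ℝ) (b : Edge n → ℝ) (G : Finset (Edge n)) :
    Set (ι → ℝ) :=
  {X | X ∈ polyhedron N b ∧ ∀ e ∈ G, dotProduct (N e) X = b e}

/-- The polyhedron is a full-dimensional polytope, and mapping `G` to `faceOf N b G` is an
inclusion-reversing bijection from the non-crossing sets of diagonals to the nonempty faces. In
particular its facets are the sets `faceOf N b {e}`, for the diagonals `e`. -/
def RealizesAssociahedron {n : ℕ} (N : Edge n → ι → ℝ) (b : Edge n → ℝ) : Prop :=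
  IsPolytope (polyhedron N b) ∧ (interior (polyhedron N b)).Nonempty ∧
  Set.BijOn (faceOf N b) (reducedComplex n) (faces (polyhedron N b)) ∧
  ∀ G ∈ reducedComplex n, ∀ G' ∈ reducedComplex n,
    faceOf N b G' ⊆ faceOf N b G ↔ G ⊆ G'

/-- The wall-crossing inequalities: for two triangulations `T₁`, `T₂` that differ in one diagonal,
every linear dependence among the vectors of their diagonals that is positive at the two diagonals
exchanged gives a positive value on the right-hand sides. -/
def WallCrossing {n : ℕ} (N : Edge n → ι → ℝ) (b : Edge n → ℝ) : Prop :=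
  ∀ (T₁ T₂ : Finset (Edge n)) (e₁ e₂ : Edge n), IsTriangulation T₁ → IsTriangulation T₂ →
    e₁ ∈ T₁ → e₁ ∉ T₂ → e₂ ∈ T₂ → e₂ ∉ T₁ → T₁.erase e₁ = T₂.erase e₂ →
    ∀ ω : Edge n → ℝ, 0 < ω e₁ → 0 < ω e₂ →
      ∑ e ∈ diagonals T₁ ∪ diagonals T₂, ω e • N e = 0 →
      0 < ∑ e ∈ diagonals T₁ ∪ diagonals T₂, ω e * b e

end Polytopes

/-- The right-hand sides `(j - i) (n + i - j)`, for `i < j`. -/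
def rhs {n : ℕ} (e : Edge n) : ℝ :=
  (((e.1.2 : ℕ) : ℝ) - ((e.1.1 : ℕ) : ℝ)) * ((n : ℝ) + ((e.1.1 : ℕ) : ℝ) - ((e.1.2 : ℕ) : ℝ))

/-- The projection of the generator of `PVplus n` that corresponds to `e`. -/
noncomputable def facetNormal {n : ℕ} (T : Finset (Edge n))
    (φ : (T → ℝ) →ₗ[ℝ] (diagonals T → ℝ)) (e : Edge n) : diagonals T → ℝ :=
  proj T φ (ray e)

end Assoc

/-!
The theorem rests on a correspondence between vectors and weighted sets of edges. The linear map
`d = sepVec n` is invertible (`sepVec_injective`): up to a factor `2`, the coefficient of an edge is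
a second difference of `d(w)`, and the same second differences are the slacks of the four-point
inequalities. So `FP n` consists of the vectors `d(w)` with `w` nonnegative on the diagonals
(`sepVec_mem_FP_iff`), and `PVplus n` of those for which moreover no two diagonals of positive
weight cross (`sepVec_mem_PVplus_iff`). Such weights are called laminations here.

Injectivity of the projection. A vector of `PVplus n` satisfies the tropical Ptolemy relation
`v e + v f = max (v g + v h) (v g' + v h')` at each crossing, so it is determined by its coordinates
in a triangulation, by induction on the number of crossings with it (`eq_of_eqOn_triangulation`).
Hence a vector has at most one expression as a sum of facet normals over a lamination
(`IsReduction.lamination_unique`). In particular the facet normals of the diagonals of any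
triangulation are independent, and the comparison of two triangulations by this independence
shows that all have as many diagonals as the fan at a vertex, namely `n - 3`.

Resolution of crossings. On the edges of `T` the sum of the separation vectors of two crossing edges
agrees with that of one of the two pairs of opposite sides of their quadrilateral, because the edges
where the one pair fails cross all edges where the other pair fails
(`NonCrossing.sep_resolution`). The right-hand sides `x (n - x)` are strictly concave in the
distance `x`, so each resolution of a crossing lowers the cost `∑ w e * rhs e`. The cost attains its
minimum on the nonnegative weights with a given image, and a minimizer has no crossing left, so it
is a lamination (`IsReduction.exists_lamination`). By uniqueness there is only one such lamination,
and the cost is strictly smaller at the lamination than at all other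
weights (`IsReduction.cost_lt`). Thus the cones of laminations form a complete simplicial fan, and
the right-hand sides define a strictly convex function on it.

The wall-crossing inequalities are a special case of `IsReduction.cost_lt`. This lemma also gives,
for each set `G` of non-crossing diagonals, a point of the polytope where exactly the inequalities
of `G` are tight (`IsReduction.exists_tight`). A linear functional is represented by a lamination,
and on the polytope it is maximal exactly at the face of the support of this lamination
(`IsReduction.maximizers_eq`). The face lattice, the normal cones, and the fact that the polyhedron
is a polytope all follow from these two lemmas.

For a diagonal `δ` of `T`, the crossing of `δ` with its rotation resolves into two sides, which are
collapsed, so the two normals are opposite (`IsReduction.facetNormal_rotate`). Conversely, if the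
normals of two diagonals cancel, then the resolution of their crossing leaves only sides, and this
forces them to be such a pair (`IsReduction.rotate_of_cancel`). The coordinates of a facet normal in
the basis given by `T` are, up to signs, half the shears of its generator at the quadrilaterals of
`T`, and the shears of a generator are `0`, `2` or `-2`
(`IsReduction.exists_coordinates`).
-/

namespace Assoc

variable {n : ℕ}

/-! ### Crossings -/

theorem Crosses.symm {e f : Edge n} (h : Crosses e f) : Crosses f e := Or.symm h

theorem not_crosses_of_not_relevant {e f : Edge n} (he : ¬ Relevant e) : ¬ Crosses e f := by
  have := e.2; have := f.2; have := e.1.2.2; have := f.1.2.2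
  simp only [Relevant, Crosses, Fin.lt_def] at *
  omega

theorem IsTriangulation.mem_of_not_crosses {T : Finset (Edge n)} (hT : IsTriangulation T)
    {e : Edge n} (he : ∀ f ∈ T, ¬ Crosses e f) : e ∈ T := by
  classical
  have hirr : ¬ Crosses e e := by
    simp only [Crosses, Fin.lt_def]; omega
  have h : NonCrossing (insert e T) := by
    intro a ha b hb
    rcases Finset.mem_insert.1 ha with ha | ha <;> rcases Finset.mem_insert.1 hb with hb | hb
    · exact ha ▸ hb ▸ hirr
    · exact ha ▸ he b hb
    · exact fun hc => he a ha (hb ▸ hc.symm)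
    · exact hT.prop a ha b hb
  exact hT.le_of_ge h (Finset.subset_insert e T) (Finset.mem_insert_self e T)

theorem IsTriangulation.mem_of_not_relevant {T : Finset (Edge n)} (hT : IsTriangulation T)
    {e : Edge n} (he : ¬ Relevant e) : e ∈ T :=
  hT.mem_of_not_crosses fun _ _ => not_crosses_of_not_relevant he

theorem exists_isTriangulation_ge {G : Finset (Edge n)} (hG : NonCrossing G) :
    ∃ T, G ⊆ T ∧ IsTriangulation T := by
  obtain ⟨T, hGT, hT⟩ := Finite.exists_le_maximal (p := NonCrossing) hG
  exact ⟨T, hGT, hT⟩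

/-- An edge that crosses a side of the quadrilateral `i < k < j < l` but not one of its diagonals
crosses the other diagonal. For `s` in a triangulation containing one of the two diagonals, it
follows that the sides of the quadrilateral have fewer crossings than the other diagonal. -/
theorem crosses_of_crosses_side {i k j l : Fin n} (h₁ : i < k) (h₂ : k < j) (h₃ : j < l)
    {s : Edge n} :
    (¬ Crosses ⟨(k, l), h₂.trans h₃⟩ s →
      (Crosses ⟨(i, k), h₁⟩ s ∨ Crosses ⟨(j, l), h₃⟩ s ∨
        Crosses ⟨(i, l), h₁.trans (h₂.trans h₃)⟩ s ∨ Crosses ⟨(k, j), h₂⟩ s) →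
      Crosses ⟨(i, j), h₁.trans h₂⟩ s) ∧
    (¬ Crosses ⟨(i, j), h₁.trans h₂⟩ s →
      (Crosses ⟨(i, k), h₁⟩ s ∨ Crosses ⟨(j, l), h₃⟩ s ∨
        Crosses ⟨(i, l), h₁.trans (h₂.trans h₃)⟩ s ∨ Crosses ⟨(k, j), h₂⟩ s) →
      Crosses ⟨(k, l), h₂.trans h₃⟩ s) := by
  obtain ⟨⟨a, b⟩, hab⟩ := s
  simp only [Crosses, Fin.lt_def] at *
  omega

/-! ### The separation vectors -/

open scoped Classical in
/-- The coordinate of `ray e` at `s`, as a number. -/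
noncomputable def sep (e s : Edge n) : ℝ := if Separates e s then 1 else 0

theorem sepVec_apply (w : Edge n → ℝ) (s : Edge n) :
    sepVec n w s = ∑ e, w e * sep e s := by
  simp [sepVec, sep]

theorem ray_apply (e s : Edge n) : ray e s = sep e s := by
  classical
  simp [ray, sepVec_apply, Pi.single_apply]

theorem sepVec_eq_sum_ray (w : Edge n → ℝ) : sepVec n w = ∑ e, w e • ray e := by
  funext s
  simp [sepVec_apply, ray_apply]

/-- The edges joining the arcs `[a, a')` and `[b, b')`. -/
def JoinsLeft (a a' b b' : Fin n) (e : Edge n) : Prop :=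
  (a ≤ e.1.1 ∧ e.1.1 < a') ∧ (b ≤ e.1.2 ∧ e.1.2 < b')

/-- The edges joining the arc `[a', b)` to the cyclic arc `[b', a)`. -/
def JoinsRight (a a' b b' : Fin n) (e : Edge n) : Prop :=
  (e.1.1 < a ∧ a' ≤ e.1.2 ∧ e.1.2 < b) ∨ (a' ≤ e.1.1 ∧ e.1.1 < b ∧ b' ≤ e.1.2)

open scoped Classical in
theorem sep_add_sub_left {a a' b b' : Fin n} (h₁ : a < a') (h₂ : a' < b) (h₃ : b < b')
    (e : Edge n) :
    sep e ⟨(a, b), h₁.trans h₂⟩ + sep e ⟨(a', b'), h₂.trans h₃⟩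
      - (sep e ⟨(a, b'), h₁.trans (h₂.trans h₃)⟩ + sep e ⟨(a', b), h₂⟩)
      = if JoinsLeft a a' b b' e then 2 else 0 := by
  obtain ⟨⟨x, y⟩, hxy⟩ := e
  replace hxy : x < y := hxy
  simp only [sep, Separates, JoinsLeft, Xor, Fin.lt_def, Fin.le_def] at *
  split_ifs <;> first | (exfalso; omega) | norm_num

open scoped Classical in
theorem sep_add_sub_right {a a' b b' : Fin n} (h₁ : a < a') (h₂ : a' < b) (h₃ : b < b')
    (e : Edge n) :
    sep e ⟨(a, b), h₁.trans h₂⟩ + sep e ⟨(a', b'), h₂.trans h₃⟩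
      - (sep e ⟨(a, a'), h₁⟩ + sep e ⟨(b, b'), h₃⟩)
      = if JoinsRight a a' b b' e then 2 else 0 := by
  obtain ⟨⟨x, y⟩, hxy⟩ := e
  replace hxy : x < y := hxy
  simp only [sep, Separates, JoinsRight, Xor, Fin.lt_def, Fin.le_def] at *
  split_ifs <;> first | (exfalso; omega) | norm_num

theorem sum_mul_ite_eq {P : Edge n → Prop} [DecidablePred P] {e : Edge n} (hP : ∀ f, P f ↔ f = e)
    (w : Edge n → ℝ) : ∑ f, w f * (if P f then 2 else 0) = 2 * w e := by
  classical
  simp [hP, mul_comm]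

open scoped Classical in
theorem sepVec_add_sub_left (w : Edge n → ℝ) {a a' b b' : Fin n} (h₁ : a < a') (h₂ : a' < b)
    (h₃ : b < b') :
    sepVec n w ⟨(a, b), h₁.trans h₂⟩ + sepVec n w ⟨(a', b'), h₂.trans h₃⟩
      - (sepVec n w ⟨(a, b'), h₁.trans (h₂.trans h₃)⟩ + sepVec n w ⟨(a', b), h₂⟩)
      = ∑ e, w e * (if JoinsLeft a a' b b' e then 2 else 0) := by
  simp only [← sep_add_sub_left h₁ h₂ h₃, sepVec_apply, ← Finset.sum_add_distrib,
    ← Finset.sum_sub_distrib]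
  exact Finset.sum_congr rfl fun e _ => by ring

open scoped Classical in
theorem sepVec_add_sub_right (w : Edge n → ℝ) {a a' b b' : Fin n} (h₁ : a < a') (h₂ : a' < b)
    (h₃ : b < b') :
    sepVec n w ⟨(a, b), h₁.trans h₂⟩ + sepVec n w ⟨(a', b'), h₂.trans h₃⟩
      - (sepVec n w ⟨(a, a'), h₁⟩ + sepVec n w ⟨(b, b'), h₃⟩)
      = ∑ e, w e * (if JoinsRight a a' b b' e then 2 else 0) := by
  simp only [← sep_add_sub_right h₁ h₂ h₃, sepVec_apply, ← Finset.sum_add_distrib,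
    ← Finset.sum_sub_distrib]
  exact Finset.sum_congr rfl fun e _ => by ring

/-- Every coefficient at a diagonal is half a slack of a four-point inequality. -/
theorem exists_slack_eq_weight {e : Edge n} (he : Relevant e) :
    ∃ (a a' b b' : Fin n) (h₁ : a < a') (h₂ : a' < b) (h₃ : b < b'),
      (∀ w : Edge n → ℝ,
        sepVec n w ⟨(a, b), h₁.trans h₂⟩ + sepVec n w ⟨(a', b'), h₂.trans h₃⟩
          - (sepVec n w ⟨(a, b'), h₁.trans (h₂.trans h₃)⟩ + sepVec n w ⟨(a', b), h₂⟩)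
          = 2 * w e) ∨
      (∀ w : Edge n → ℝ,
        sepVec n w ⟨(a, b), h₁.trans h₂⟩ + sepVec n w ⟨(a', b'), h₂.trans h₃⟩
          - (sepVec n w ⟨(a, a'), h₁⟩ + sepVec n w ⟨(b, b'), h₃⟩) = 2 * w e) := by
  classical
  obtain ⟨⟨i, j⟩, hij⟩ := e
  obtain ⟨h₁, h₂⟩ : (i : ℕ) + 1 < j ∧ (j : ℕ) + 1 < i + n := he
  have hi := i.2
  have hj := j.2
  have hi₁ : i < ⟨i + 1, by omega⟩ := Fin.lt_def.2 (Nat.lt_succ_self _)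
  have hij₁ : (⟨i + 1, by omega⟩ : Fin n) < j := Fin.lt_def.2 h₁
  by_cases hjn : (j : ℕ) + 1 < n
  · have hj₁ : j < ⟨j + 1, hjn⟩ := Fin.lt_def.2 (Nat.lt_succ_self _)
    refine ⟨i, _, j, _, hi₁, hij₁, hj₁, Or.inl fun w => ?_⟩
    rw [sepVec_add_sub_left w hi₁ hij₁ hj₁]
    refine sum_mul_ite_eq (fun f => ?_) w
    simp only [JoinsLeft, Subtype.ext_iff, Prod.ext_iff, Fin.ext_iff, Fin.lt_def, Fin.le_def]
    omega
  · have h0i : (⟨0, by omega⟩ : Fin n) < i := Fin.lt_def.2 (show 0 < (i : ℕ) by omega)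
    refine ⟨_, i, _, j, h0i, hi₁, hij₁, Or.inr fun w => ?_⟩
    rw [sepVec_add_sub_right w h0i hi₁ hij₁]
    refine sum_mul_ite_eq (fun f => ?_) w
    have := f.1.2.2
    simp only [JoinsRight, Subtype.ext_iff, Prod.ext_iff, Fin.ext_iff, Fin.lt_def, Fin.le_def]
    omega

open scoped Classical in
/-- For three polygon sides `a < b < c`, each combination of the three separation coordinates
with one negative sign counts the edges joining two of the three arcs. -/
theorem sep_triangle {a b c : Fin n} (h₁ : a < b) (h₂ : b < c) (e : Edge n) :
    sep e ⟨(a, b), h₁⟩ + sep e ⟨(b, c), h₂⟩ - sep e ⟨(a, c), h₁.trans h₂⟩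
      = (if a ≤ e.1.1 ∧ e.1.1 < b ∧ b ≤ e.1.2 ∧ e.1.2 < c then 2 else 0) ∧
    sep e ⟨(b, c), h₂⟩ + sep e ⟨(a, c), h₁.trans h₂⟩ - sep e ⟨(a, b), h₁⟩
      = (if (e.1.1 < a ∧ b ≤ e.1.2 ∧ e.1.2 < c) ∨ (b ≤ e.1.1 ∧ e.1.1 < c ∧ c ≤ e.1.2)
          then 2 else 0) ∧
    sep e ⟨(a, b), h₁⟩ + sep e ⟨(a, c), h₁.trans h₂⟩ - sep e ⟨(b, c), h₂⟩
      = (if (e.1.1 < a ∧ a ≤ e.1.2 ∧ e.1.2 < b) ∨ (a ≤ e.1.1 ∧ e.1.1 < b ∧ c ≤ e.1.2)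
          then 2 else 0) := by
  obtain ⟨⟨x, y⟩, hxy⟩ := e
  replace hxy : x < y := hxy
  simp only [sep, Separates, Xor, Fin.lt_def, Fin.le_def] at *
  refine ⟨?_, ?_, ?_⟩ <;> split_ifs <;> first | (exfalso; omega) | norm_num

/-- The coefficient of a side of the polygon is half a combination of the three separation
coordinates of a suitable triangle. -/
theorem weight_eq_zero_of_side (hn : 3 ≤ n) {w : Edge n → ℝ} (hw : sepVec n w = 0) {e : Edge n}
    (he : ¬ Relevant e) : w e = 0 := by
  classical
  have key : ∀ {a b c : Fin n} (h₁ : a < b) (h₂ : b < c),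
      (∑ f, w f * (if a ≤ f.1.1 ∧ f.1.1 < b ∧ b ≤ f.1.2 ∧ f.1.2 < c then 2 else 0) = 0) ∧
      (∑ f, w f * (if (f.1.1 < a ∧ b ≤ f.1.2 ∧ f.1.2 < c) ∨ (b ≤ f.1.1 ∧ f.1.1 < c ∧ c ≤ f.1.2)
          then 2 else 0) = 0) ∧
      (∑ f, w f * (if (f.1.1 < a ∧ a ≤ f.1.2 ∧ f.1.2 < b) ∨ (a ≤ f.1.1 ∧ f.1.1 < b ∧ c ≤ f.1.2)
          then 2 else 0) = 0) := by
    intro a b c h₁ h₂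
    have h0 : ∀ s, ∑ f, w f * sep f s = 0 := fun s => by rw [← sepVec_apply, hw]; rfl
    simp only [← (sep_triangle h₁ h₂ _).1, ← (sep_triangle h₁ h₂ _).2.1,
      ← (sep_triangle h₁ h₂ _).2.2, mul_sub, mul_add, Finset.sum_add_distrib,
      Finset.sum_sub_distrib, h0]
    norm_num
  obtain ⟨⟨i, j⟩, hij⟩ := e
  replace he : ¬ ((i : ℕ) + 1 < j ∧ (j : ℕ) + 1 < i + n) := he
  have hij' : (i : ℕ) < j := hij
  have hi := i.2
  have hj := j.2
  suffices h : 2 * w ⟨(i, j), hij⟩ = 0 by linarith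
  by_cases h1 : (j : ℕ) = i + 1
  · by_cases h2 : (j : ℕ) + 1 < n
    · rw [← (key (a := i) (b := j) (c := ⟨j + 1, h2⟩) hij (Fin.lt_def.2 (Nat.lt_succ_self _))).1]
      refine (sum_mul_ite_eq (fun f => ?_) w).symm
      simp only [Subtype.ext_iff, Prod.ext_iff, Fin.ext_iff, Fin.lt_def, Fin.le_def]
      omega
    · rw [← (key (a := ⟨0, by omega⟩) (b := i) (c := j) (Fin.lt_def.2 (by simp; omega)) hij).2.1]
      refine (sum_mul_ite_eq (fun f => ?_) w).symm
      have := f.1.2.2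
      simp only [Subtype.ext_iff, Prod.ext_iff, Fin.ext_iff, Fin.lt_def, Fin.le_def]
      omega
  · rw [← (key (a := i) (b := ⟨1, by omega⟩) (c := j) (Fin.lt_def.2 (by simp; omega))
      (Fin.lt_def.2 (by simp; omega))).2.2]
    refine (sum_mul_ite_eq (fun f => ?_) w).symm
    have := f.1.2.2
    simp only [Subtype.ext_iff, Prod.ext_iff, Fin.ext_iff, Fin.lt_def, Fin.le_def]
    omega

theorem sepVec_injective (hn : 3 ≤ n) : Function.Injective (sepVec n) := by
  rw [injective_iff_map_eq_zero]
  intro w hw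
  funext e
  by_cases he : Relevant e
  · obtain ⟨a, a', b, b', h₁, h₂, h₃, h | h⟩ := exists_slack_eq_weight he
    all_goals
      have := h w
      simp only [hw, Pi.zero_apply] at this ⊢
      linarith
  · exact weight_eq_zero_of_side hn hw he

theorem sepVec_surjective (hn : 3 ≤ n) : Function.Surjective (sepVec n) :=
  LinearMap.injective_iff_surjective.1 (sepVec_injective hn)

theorem mem_irrelevantSpace_iff {v : Edge n → ℝ} :
    v ∈ irrelevantSpace n ↔ ∃ w : Edge n → ℝ, (∀ e, Relevant e → w e = 0) ∧ v = sepVec n w := by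
  constructor
  · intro hv
    refine Submodule.span_induction (p := fun v _ => ∃ w : Edge n → ℝ,
      (∀ e, Relevant e → w e = 0) ∧ v = sepVec n w) ?_ ?_ ?_ ?_ hv
    · rintro _ ⟨e, he, rfl⟩
      refine ⟨Pi.single e 1, fun f hf => ?_, rfl⟩
      rw [Pi.single_apply, if_neg]
      rintro rfl
      exact he hf
    · exact ⟨0, by simp, by simp⟩
    · rintro _ _ _ _ ⟨w, hw, rfl⟩ ⟨w', hw', rfl⟩
      exact ⟨w + w', fun e he => by simp [hw e he, hw' e he], by simp⟩
    · rintro c _ _ ⟨w, hw, rfl⟩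
      exact ⟨c • w, fun e he => by simp [hw e he], by simp⟩
  · rintro ⟨w, hw, rfl⟩
    rw [sepVec_eq_sum_ray]
    refine Submodule.sum_mem _ fun e _ => ?_
    by_cases he : Relevant e
    · simp [hw e he]
    · exact Submodule.smul_mem _ _ (Submodule.subset_span ⟨e, he, rfl⟩)

/-! ### Laminations and the fan of non-crossing weights -/

/-- A lamination: nonnegative weights on pairwise non-crossing diagonals. -/
structure IsLamination (w : Edge n → ℝ) : Prop where
  nonneg : ∀ e, 0 ≤ w e
  support : ∀ e, ¬ Relevant e → w e = 0
  noncrossing : ∀ e f, Crosses e f → w e = 0 ∨ w f = 0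

/-- The part of a weight vector that lives on the diagonals. -/
def relevantPart (w : Edge n → ℝ) : Edge n → ℝ := fun e => if Relevant e then w e else 0

theorem relevantPart_of_relevant (w : Edge n → ℝ) {e : Edge n} (he : Relevant e) :
    relevantPart w e = w e := if_pos he

theorem relevantPart_of_not_relevant (w : Edge n → ℝ) {e : Edge n} (he : ¬ Relevant e) :
    relevantPart w e = 0 := if_neg he

theorem JoinsLeft.relevant {a a' b b' : Fin n} (h₂ : a' < b) {e : Edge n}
    (he : JoinsLeft a a' b b' e) : Relevant e := by
  obtain ⟨⟨x, y⟩, hxy⟩ := e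
  have := b'.2
  simp only [JoinsLeft, Relevant, Fin.lt_def, Fin.le_def] at *
  omega

theorem JoinsRight.relevant {a a' b b' : Fin n} (h₁ : a < a') (h₃ : b < b') {e : Edge n}
    (he : JoinsRight a a' b b' e) : Relevant e := by
  obtain ⟨⟨x, y⟩, hxy⟩ := e
  have := b'.2
  have := y.2
  simp only [JoinsRight, Relevant, Fin.lt_def, Fin.le_def] at *
  omega

theorem JoinsLeft.crosses {a a' b b' : Fin n} {e f : Edge n}
    (he : JoinsLeft a a' b b' e) (hf : JoinsRight a a' b b' f) : Crosses e f := by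
  simp only [JoinsLeft, JoinsRight, Crosses, Fin.lt_def, Fin.le_def] at *
  omega

theorem sepVec_mem_FP_iff {w : Edge n → ℝ} :
    sepVec n w ∈ FP n ↔ ∀ e, Relevant e → 0 ≤ w e := by
  classical
  constructor
  · intro hw e he
    obtain ⟨a, a', b, b', h₁, h₂, h₃, h | h⟩ := exists_slack_eq_weight he
    · linarith [h w, (le_max_right _ _).trans (hw a a' b b' h₁ h₂ h₃)]
    · linarith [h w, (le_max_left _ _).trans (hw a a' b b' h₁ h₂ h₃)]
  · intro hw a a' b b' h₁ h₂ h₃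
    refine max_le ?_ ?_
    · rw [← sub_nonneg, sepVec_add_sub_right w h₁ h₂ h₃]
      refine Finset.sum_nonneg fun e _ => ?_
      split_ifs with h
      · exact mul_nonneg (hw e (h.relevant h₁ h₃)) zero_le_two
      · simp
    · rw [← sub_nonneg, sepVec_add_sub_left w h₁ h₂ h₃]
      refine Finset.sum_nonneg fun e _ => ?_
      split_ifs with h
      · exact mul_nonneg (hw e (h.relevant h₂)) zero_le_two
      · simp

/-- The positive part of the prevariety consists of the vectors `d(w)` for which `w` is a
lamination up to its values on the sides of the polygon. -/
theorem sepVec_mem_PVplus_iff {w : Edge n → ℝ} :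
    sepVec n w ∈ PVplus n ↔ IsLamination (relevantPart w) := by
  classical
  have hnn : sepVec n w ∈ FP n → ∀ (a a' b b' : Fin n) (_ : a < a') (_ : a' < b) (_ : b < b'),
      (∀ e ∈ Finset.univ, 0 ≤ w e * (if JoinsLeft a a' b b' e then (2 : ℝ) else 0)) ∧
      (∀ e ∈ Finset.univ, 0 ≤ w e * (if JoinsRight a a' b b' e then (2 : ℝ) else 0)) := by
    intro hw a a' b b' h₁ h₂ h₃
    rw [sepVec_mem_FP_iff] at hw
    constructor <;> intro e _ <;> split_ifs with h
    · exact mul_nonneg (hw e (h.relevant h₂)) zero_le_two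
    · simp
    · exact mul_nonneg (hw e (h.relevant h₁ h₃)) zero_le_two
    · simp
  constructor
  · rintro ⟨hP, hF⟩
    have hw := sepVec_mem_FP_iff.1 hF
    have main : ∀ e f : Edge n, Relevant e → Relevant f →
        (e.1.1 < f.1.1 ∧ f.1.1 < e.1.2 ∧ e.1.2 < f.1.2) → w e = 0 ∨ w f = 0 := by
      rintro ⟨⟨i, j⟩, hij⟩ ⟨⟨k, l⟩, hkl⟩ he hf ⟨h₁, h₂, h₃⟩
      have hL := sepVec_add_sub_left w h₁ h₂ h₃
      have hR := sepVec_add_sub_right w h₁ h₂ h₃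
      have hL' := Finset.single_le_sum (hnn hF i k j l h₁ h₂ h₃).1
        (Finset.mem_univ ⟨(i, j), hij⟩)
      have hR' := Finset.single_le_sum (hnn hF i k j l h₁ h₂ h₃).2
        (Finset.mem_univ ⟨(k, l), hkl⟩)
      rw [if_pos (by simp only [JoinsLeft, le_refl, true_and]; exact ⟨h₁, h₃⟩)] at hL'
      rw [if_pos (by simp only [JoinsRight, le_refl, true_and]; exact Or.inr ⟨h₂, trivial⟩)] at hR'
      have he0 := hw _ he
      have hf0 := hw _ hf
      rcases hP i k j l h₁ h₂ h₃ with h | h | h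
      · right; simp only at *; linarith
      · left; simp only at *; linarith
      · have := max_le_iff.1 (hF i k j l h₁ h₂ h₃)
        left; simp only at *; linarith
    refine ⟨fun e => ?_, fun e he => relevantPart_of_not_relevant w he, fun e f hef => ?_⟩
    · by_cases he : Relevant e
      · rw [relevantPart_of_relevant w he]; exact hw e he
      · rw [relevantPart_of_not_relevant w he]
    · by_cases he : Relevant e
      · by_cases hf : Relevant f
        · rw [relevantPart_of_relevant w he, relevantPart_of_relevant w hf]
          rcases hef with h | h
          · exact main e f he hf h
          · exact (main f e hf he h).symm
        · exact Or.inr (relevantPart_of_not_relevant w hf)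
      · exact Or.inl (relevantPart_of_not_relevant w he)
  · intro hw
    have hF : sepVec n w ∈ FP n := sepVec_mem_FP_iff.2 fun e he => by
      rw [← relevantPart_of_relevant w he]; exact hw.nonneg e
    refine ⟨fun a a' b b' h₁ h₂ h₃ => ?_, hF⟩
    have hL := sepVec_add_sub_left w h₁ h₂ h₃
    have hR := sepVec_add_sub_right w h₁ h₂ h₃
    have hmax := max_le_iff.1 (hF a a' b b' h₁ h₂ h₃)
    by_cases hl : ∃ e, JoinsLeft a a' b b' e ∧ w e ≠ 0
    · obtain ⟨e, he, hwe⟩ := hl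
      rw [Finset.sum_eq_zero] at hR
      · exact Or.inl ⟨by linarith, hmax.2⟩
      · intro f _
        split_ifs with hf
        · rcases hw.noncrossing e f (he.crosses hf) with h | h
          · rw [relevantPart_of_relevant w (he.relevant h₂)] at h
            exact absurd h hwe
          · rw [relevantPart_of_relevant w (hf.relevant h₁ h₃)] at h
            simp [h]
        · simp
    · rw [Finset.sum_eq_zero] at hL
      · exact Or.inr (Or.inl ⟨by linarith, hmax.1⟩)
      · intro f _
        split_ifs with hf
        · by_contra h
          exact hl ⟨f, hf, fun h0 => h (by simp [h0])⟩
        · simp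

theorem PVplus_add_mem {v u : Edge n → ℝ} (hn : 3 ≤ n) (hv : v ∈ PVplus n)
    (hu : u ∈ irrelevantSpace n) : v + u ∈ PVplus n := by
  obtain ⟨w, rfl⟩ := sepVec_surjective hn v
  obtain ⟨x, hx, rfl⟩ := mem_irrelevantSpace_iff.1 hu
  rw [← map_add, sepVec_mem_PVplus_iff]
  rw [sepVec_mem_PVplus_iff] at hv
  convert hv using 1
  funext e
  by_cases he : Relevant e
  · simp [relevantPart_of_relevant _ he, hx e he]
  · simp [relevantPart_of_not_relevant _ he]

theorem IsLamination.relevantPart_eq {w : Edge n → ℝ} (hw : IsLamination w) :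
    relevantPart w = w := by
  funext e
  by_cases he : Relevant e
  · exact relevantPart_of_relevant w he
  · rw [relevantPart_of_not_relevant w he, hw.support e he]

theorem IsLamination.sepVec_mem {w : Edge n → ℝ} (hw : IsLamination w) :
    sepVec n w ∈ PVplus n :=
  sepVec_mem_PVplus_iff.2 (hw.relevantPart_eq.symm ▸ hw)

/-! ### Restriction to a triangulation -/

/-- On the positive part of the prevariety the crossing matching has the maximal weight
(the tropical Ptolemy relation). -/
theorem ptolemy {v : Edge n → ℝ} (hv : v ∈ PVplus n) {i k j l : Fin n} (h₁ : i < k) (h₂ : k < j)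
    (h₃ : j < l) :
    v ⟨(i, j), h₁.trans h₂⟩ + v ⟨(k, l), h₂.trans h₃⟩ =
      max (v ⟨(i, k), h₁⟩ + v ⟨(j, l), h₃⟩)
        (v ⟨(i, l), h₁.trans (h₂.trans h₃)⟩ + v ⟨(k, j), h₂⟩) := by
  refine le_antisymm ?_ (hv.2 i k j l h₁ h₂ h₃)
  rcases hv.1 i k j l h₁ h₂ h₃ with h | h | h
  · exact le_max_of_le_left h.1.le
  · exact le_max_of_le_right h.1.le
  · exact (h.2.trans (le_max_left _ _))

/-- A point of the positive part of the prevariety is determined by its coordinates in a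
triangulation. -/
theorem eq_of_eqOn_triangulation {T : Finset (Edge n)} (hT : IsTriangulation T)
    {v v' : Edge n → ℝ} (hv : v ∈ PVplus n) (hv' : v' ∈ PVplus n) (h : ∀ e ∈ T, v e = v' e) :
    v = v' := by
  classical
  suffices H : ∀ (N : ℕ) (e : Edge n), (T.filter (Crosses e)).card = N → v e = v' e from
    funext fun e => H _ e rfl
  intro N
  induction N using Nat.strong_induction_on with
  | _ N ih =>
    rintro e rfl
    by_cases he : ∀ f ∈ T, ¬ Crosses e f
    · exact h e (hT.mem_of_not_crosses he)
    push Not at he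
    obtain ⟨f, hf, hef⟩ := he
    have hfT : ∀ s ∈ T, ¬ Crosses f s := fun s hs => hT.prop f hf s hs
    have side : ∀ g : Edge n, ¬ Crosses g f → (∀ s ∈ T, Crosses g s → Crosses e s) →
        v g = v' g := by
      intro g hgf hg
      refine ih _ (Finset.card_lt_card ?_) g rfl
      refine (Finset.ssubset_iff_of_subset fun s hs => ?_).2 ⟨f, by simp [hf, hef], by simp [hgf]⟩
      simp only [Finset.mem_filter] at hs ⊢
      exact ⟨hs.1, hg s hs.1 hs.2⟩
    have sides : ∀ {i k j l : Fin n} (h₁ : i < k) (h₂ : k < j) (h₃ : j < l),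
        (e = ⟨(i, j), h₁.trans h₂⟩ ∧ f = ⟨(k, l), h₂.trans h₃⟩ ∨
          f = ⟨(i, j), h₁.trans h₂⟩ ∧ e = ⟨(k, l), h₂.trans h₃⟩) → v e = v' e := by
      intro i k j l h₁ h₂ h₃ hcase
      have hg : ∀ s ∈ T, (Crosses ⟨(i, k), h₁⟩ s ∨ Crosses ⟨(j, l), h₃⟩ s ∨
          Crosses ⟨(i, l), h₁.trans (h₂.trans h₃)⟩ s ∨ Crosses ⟨(k, j), h₂⟩ s) →
          Crosses e s := by
        intro s hs
        rcases hcase with ⟨rfl, rfl⟩ | ⟨rfl, rfl⟩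
        · exact (crosses_of_crosses_side h₁ h₂ h₃).1 (hfT s hs)
        · exact (crosses_of_crosses_side h₁ h₂ h₃).2 (hfT s hs)
      have hnf : ¬ Crosses ⟨(i, k), h₁⟩ f ∧ ¬ Crosses ⟨(j, l), h₃⟩ f ∧
          ¬ Crosses ⟨(i, l), h₁.trans (h₂.trans h₃)⟩ f ∧ ¬ Crosses ⟨(k, j), h₂⟩ f := by
        rcases hcase with ⟨rfl, rfl⟩ | ⟨rfl, rfl⟩ <;> simp only [Crosses, Fin.lt_def] at * <;> omega
      have e1 := side _ hnf.1 fun s hs hc => hg s hs (Or.inl hc)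
      have e2 := side _ hnf.2.1 fun s hs hc => hg s hs (Or.inr (Or.inl hc))
      have e3 := side _ hnf.2.2.1 fun s hs hc => hg s hs (Or.inr (Or.inr (Or.inl hc)))
      have e4 := side _ hnf.2.2.2 fun s hs hc => hg s hs (Or.inr (Or.inr (Or.inr hc)))
      have p := ptolemy hv h₁ h₂ h₃
      have p' := ptolemy hv' h₁ h₂ h₃
      rw [e1, e2, e3, e4, ← p'] at p
      have hf' := h f hf
      rcases hcase with ⟨rfl, rfl⟩ | ⟨rfl, rfl⟩ <;> linarith
    rcases hef with ⟨h₁, h₂, h₃⟩ | ⟨h₁, h₂, h₃⟩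
    · exact sides h₁ h₂ h₃ (Or.inl ⟨rfl, rfl⟩)
    · exact sides h₁ h₂ h₃ (Or.inr ⟨rfl, rfl⟩)

/-- Two points of the positive part of the prevariety have the same image modulo the projected
irrelevant space only if they are congruent modulo the irrelevant space. -/
theorem sub_mem_irrelevantSpace (hn : 3 ≤ n) {T : Finset (Edge n)} (hT : IsTriangulation T)
    {v v' : Edge n → ℝ} (hv : v ∈ PVplus n) (hv' : v' ∈ PVplus n)
    (h : restrict T (v - v') ∈ (irrelevantSpace n).map (restrict T)) :
    v - v' ∈ irrelevantSpace n := by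
  obtain ⟨u, hu, huv⟩ := h
  have : v = v' + u := by
    refine eq_of_eqOn_triangulation hT hv (PVplus_add_mem hn hv' hu) fun e he => ?_
    have := congrFun huv ⟨e, he⟩
    simp only [restrict, LinearMap.funLeft_apply, Pi.sub_apply, Pi.add_apply] at this ⊢
    linarith
  rw [this, add_sub_cancel_left]
  exact hu

/-! ### Resolving a crossing -/

/-- The separation vectors of two crossing edges `{i, j}` and `{k, l}` agree, at any given edge `s`,
with those of either pair of opposite sides of their quadrilateral, unless `s` separates the one
side of the pair from the other. -/
theorem sep_resolution {i k j l : Fin n} (h₁ : i < k) (h₂ : k < j) (h₃ : j < l) (s : Edge n) :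
    (sep ⟨(i, j), h₁.trans h₂⟩ s + sep ⟨(k, l), h₂.trans h₃⟩ s
        = sep ⟨(i, k), h₁⟩ s + sep ⟨(j, l), h₃⟩ s ∨
      (s.1.1 ≤ i ∧ k < s.1.2 ∧ s.1.2 ≤ j) ∨ (k < s.1.1 ∧ s.1.1 ≤ j ∧ l < s.1.2)) ∧
    (sep ⟨(i, j), h₁.trans h₂⟩ s + sep ⟨(k, l), h₂.trans h₃⟩ s
        = sep ⟨(i, l), h₁.trans (h₂.trans h₃)⟩ s + sep ⟨(k, j), h₂⟩ s ∨
      (i < s.1.1 ∧ s.1.1 ≤ k ∧ j < s.1.2 ∧ s.1.2 ≤ l)) := by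
  classical
  obtain ⟨⟨x, y⟩, hxy⟩ := s
  replace hxy : x < y := hxy
  constructor
  all_goals
    rw [or_iff_not_imp_right]
    intro h
    simp only [sep, Separates, Xor, Fin.lt_def, Fin.le_def] at *
    split_ifs <;> first | (exfalso; omega) | norm_num

/-- On a non-crossing set of edges one of the two resolutions of a crossing is valid everywhere,
because the exceptional edges of the one cross the exceptional edges of the other. -/
theorem NonCrossing.sep_resolution {T : Finset (Edge n)} (hT : NonCrossing T) {i k j l : Fin n}
    (h₁ : i < k) (h₂ : k < j) (h₃ : j < l) :
    ((∀ s ∈ T, ¬ ((s.1.1 ≤ i ∧ k < s.1.2 ∧ s.1.2 ≤ j) ∨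
        (k < s.1.1 ∧ s.1.1 ≤ j ∧ l < s.1.2))) ∧
      ∀ s ∈ T, sep ⟨(i, j), h₁.trans h₂⟩ s + sep ⟨(k, l), h₂.trans h₃⟩ s
        = sep ⟨(i, k), h₁⟩ s + sep ⟨(j, l), h₃⟩ s) ∨
    ((∀ s ∈ T, ¬ (i < s.1.1 ∧ s.1.1 ≤ k ∧ j < s.1.2 ∧ s.1.2 ≤ l)) ∧
      ∀ s ∈ T, sep ⟨(i, j), h₁.trans h₂⟩ s + sep ⟨(k, l), h₂.trans h₃⟩ s
        = sep ⟨(i, l), h₁.trans (h₂.trans h₃)⟩ s + sep ⟨(k, j), h₂⟩ s) := by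
  by_cases h : ∀ s ∈ T, ¬ ((s.1.1 ≤ i ∧ k < s.1.2 ∧ s.1.2 ≤ j) ∨
        (k < s.1.1 ∧ s.1.1 ≤ j ∧ l < s.1.2))
  · exact Or.inl ⟨h, fun s hs => (Assoc.sep_resolution h₁ h₂ h₃ s).1.resolve_right (h s hs)⟩
  · push Not at h
    obtain ⟨t, ht, hst⟩ := h
    have h' : ∀ s ∈ T, ¬ (i < s.1.1 ∧ s.1.1 ≤ k ∧ j < s.1.2 ∧ s.1.2 ≤ l) := by
      intro s hs hs'
      refine hT s hs t ht ?_
      simp only [Crosses, Fin.lt_def, Fin.le_def] at *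
      omega
    exact Or.inr ⟨h', fun s hs => (Assoc.sep_resolution h₁ h₂ h₃ s).2.resolve_right (h' s hs)⟩

theorem rhs_pos (e : Edge n) : 0 < rhs e := by
  have h1 : ((e.1.1 : ℕ) : ℝ) < (e.1.2 : ℕ) := by exact_mod_cast e.2
  have h2 : ((e.1.2 : ℕ) : ℝ) < n := by exact_mod_cast e.1.2.2
  have h3 : (0 : ℝ) ≤ ((e.1.1 : ℕ) : ℝ) := by positivity
  exact mul_pos (by linarith) (by linarith)

/-- The right-hand sides strictly decrease under both resolutions of a crossing, by strict
concavity of `x ↦ x (n - x)`. -/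
theorem rhs_resolution {i k j l : Fin n} (h₁ : i < k) (h₂ : k < j) (h₃ : j < l) :
    rhs ⟨(i, k), h₁⟩ + rhs ⟨(j, l), h₃⟩
      < rhs ⟨(i, j), h₁.trans h₂⟩ + rhs ⟨(k, l), h₂.trans h₃⟩ ∧
    rhs ⟨(i, l), h₁.trans (h₂.trans h₃)⟩ + rhs ⟨(k, j), h₂⟩
      < rhs ⟨(i, j), h₁.trans h₂⟩ + rhs ⟨(k, l), h₂.trans h₃⟩ := by
  have e1 : ((i : ℕ) : ℝ) < (k : ℕ) := by exact_mod_cast h₁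
  have e2 : ((k : ℕ) : ℝ) < (j : ℕ) := by exact_mod_cast h₂
  have e3 : ((j : ℕ) : ℝ) < (l : ℕ) := by exact_mod_cast h₃
  have e4 : ((l : ℕ) : ℝ) < n := by exact_mod_cast l.2
  have e5 : (0 : ℝ) ≤ ((i : ℕ) : ℝ) := by positivity
  have p1 := mul_pos (sub_pos.2 e1) (sub_pos.2 e3)
  have p2 := mul_pos (sub_pos.2 e2) (show (0 : ℝ) < n - ((l : ℕ) : ℝ) + ((i : ℕ) : ℝ) by linarith)
  simp only [rhs]
  constructor <;> nlinarith

/-! ### Facet normals -/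

section

variable {T : Finset (Edge n)} {φ : (T → ℝ) →ₗ[ℝ] (diagonals T → ℝ)}

theorem proj_sepVec (w : Edge n → ℝ) :
    proj T φ (sepVec n w) = ∑ e, w e • facetNormal T φ e := by
  simp [sepVec_eq_sum_ray, facetNormal]

theorem IsReduction.proj_eq_zero_iff (hφ : IsReduction T φ) {v : Edge n → ℝ} :
    proj T φ v = 0 ↔ restrict T v ∈ (irrelevantSpace n).map (restrict T) := by
  rw [← hφ.2, LinearMap.mem_ker]
  rfl

theorem IsReduction.proj_eq_zero (hφ : IsReduction T φ) {v : Edge n → ℝ}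
    (hv : v ∈ irrelevantSpace n) : proj T φ v = 0 :=
  hφ.proj_eq_zero_iff.2 (Submodule.mem_map_of_mem hv)

theorem IsReduction.facetNormal_of_not_relevant (hφ : IsReduction T φ) {e : Edge n}
    (he : ¬ Relevant e) : facetNormal T φ e = 0 :=
  hφ.proj_eq_zero (Submodule.subset_span ⟨e, he, rfl⟩)

theorem IsReduction.proj_eq_iff (hn : 3 ≤ n) (hT : IsTriangulation T) (hφ : IsReduction T φ)
    {v v' : Edge n → ℝ} (hv : v ∈ PVplus n) (hv' : v' ∈ PVplus n) :
    proj T φ v = proj T φ v' ↔ v - v' ∈ irrelevantSpace n := by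
  rw [← sub_eq_zero, ← map_sub]
  exact ⟨fun h => sub_mem_irrelevantSpace hn hT hv hv' (hφ.proj_eq_zero_iff.1 h),
    hφ.proj_eq_zero⟩

theorem IsReduction.sum_relevantPart (hφ : IsReduction T φ) (w : Edge n → ℝ) :
    ∑ e, relevantPart w e • facetNormal T φ e = ∑ e, w e • facetNormal T φ e := by
  refine Finset.sum_congr rfl fun e _ => ?_
  by_cases he : Relevant e
  · rw [relevantPart_of_relevant w he]
  · simp [hφ.facetNormal_of_not_relevant he]

/-- A vector is a nonnegative combination of facet normals over a lamination in at most one way. -/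
theorem IsReduction.lamination_unique (hn : 3 ≤ n) (hT : IsTriangulation T)
    (hφ : IsReduction T φ) {w w' : Edge n → ℝ} (hw : IsLamination w) (hw' : IsLamination w')
    (h : ∑ e, w e • facetNormal T φ e = ∑ e, w' e • facetNormal T φ e) : w = w' := by
  rw [← proj_sepVec, ← proj_sepVec, hφ.proj_eq_iff hn hT hw.sepVec_mem hw'.sepVec_mem,
    ← map_sub, mem_irrelevantSpace_iff] at h
  obtain ⟨u, hu, huw⟩ := h
  have huw := sepVec_injective hn huw
  funext e
  by_cases he : Relevant e
  · have := congrFun huw e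
    rw [hu e he] at this
    exact sub_eq_zero.1 this
  · rw [hw.support e he, hw'.support e he]

theorem facetNormal_add_eq {e f g h : Edge n}
    (H : ∀ s ∈ T, sep e s + sep f s = sep g s + sep h s) :
    facetNormal T φ e + facetNormal T φ f = facetNormal T φ g + facetNormal T φ h := by
  simp only [facetNormal, ← map_add]
  simp only [proj, LinearMap.comp_apply]
  congr 1
  funext s
  simpa [restrict, LinearMap.funLeft_apply, ray_apply] using H s.1 s.2

theorem NonCrossing.facetNormal_resolution (hT : NonCrossing T) {e f : Edge n}
    (hef : Crosses e f) : ∃ g h : Edge n,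
      facetNormal T φ e + facetNormal T φ f = facetNormal T φ g + facetNormal T φ h ∧
      rhs g + rhs h < rhs e + rhs f := by
  have main : ∀ {i k j l : Fin n} (h₁ : i < k) (h₂ : k < j) (h₃ : j < l), ∃ g h : Edge n,
      facetNormal T φ ⟨(i, j), h₁.trans h₂⟩ + facetNormal T φ ⟨(k, l), h₂.trans h₃⟩
        = facetNormal T φ g + facetNormal T φ h ∧
      rhs g + rhs h < rhs ⟨(i, j), h₁.trans h₂⟩ + rhs ⟨(k, l), h₂.trans h₃⟩ := by
    intro i k j l h₁ h₂ h₃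
    rcases hT.sep_resolution h₁ h₂ h₃ with h | h
    · exact ⟨_, _, facetNormal_add_eq h.2, (rhs_resolution h₁ h₂ h₃).1⟩
    · exact ⟨_, _, facetNormal_add_eq h.2, (rhs_resolution h₁ h₂ h₃).2⟩
  rcases hef with ⟨h₁, h₂, h₃⟩ | ⟨h₁, h₂, h₃⟩
  · exact main h₁ h₂ h₃
  · obtain ⟨g, h, H, hlt⟩ := main h₁ h₂ h₃
    exact ⟨g, h, by rw [add_comm, H], by rw [add_comm (rhs e)]; exact hlt⟩

/-! ### Linear independence and the number of diagonals -/

/-- The facet normals of pairwise non-crossing diagonals are linearly independent: the positive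
and the negative part of a linear relation are laminations with the same image. -/
theorem IsReduction.eq_zero_of_sum_eq_zero (hn : 3 ≤ n) (hT : IsTriangulation T)
    (hφ : IsReduction T φ) {G : Finset (Edge n)} (hG : G ∈ reducedComplex n) {ω : Edge n → ℝ}
    (hω : ∀ e, e ∉ G → ω e = 0) (h : ∑ e, ω e • facetNormal T φ e = 0) : ω = 0 := by
  have lam : ∀ u : Edge n → ℝ, (∀ e, 0 ≤ u e) → (∀ e, e ∉ G → u e = 0) → IsLamination u := by
    refine fun u h0 hu => ⟨h0, fun e he => hu e fun heG => he (hG.2 e heG), fun e f hef => ?_⟩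
    by_contra! hne
    exact hG.1 e (by_contra fun h => hne.1 (hu e h)) f (by_contra fun h => hne.2 (hu f h)) hef
  have key : (fun e => max (ω e) 0) = fun e => max (-ω e) 0 := by
    refine hφ.lamination_unique hn hT
      (lam _ (fun e => le_max_right _ _) fun e he => by simp [hω e he])
      (lam _ (fun e => le_max_right _ _) fun e he => by simp [hω e he]) ?_
    rw [← sub_eq_zero, ← Finset.sum_sub_distrib, ← h]
    refine Finset.sum_congr rfl fun e _ => ?_
    rw [← sub_smul]
    congr 1
    rcases le_total (ω e) 0 with h | h
    · simp [h]
    · simp [h]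
  funext e
  have := congrFun key e
  rcases le_total (ω e) 0 with h | h
  · simp [h] at this; simpa using this
  · simp [h] at this; simpa using this

theorem IsTriangulation.diagonals_mem (hT : IsTriangulation T) :
    diagonals T ∈ reducedComplex n :=
  ⟨fun e he f hf => hT.prop e (Finset.mem_filter.1 he).1 f (Finset.mem_filter.1 hf).1,
    fun _ he => (Finset.mem_filter.1 he).2⟩

theorem IsReduction.linearIndepOn (hn : 3 ≤ n) (hT : IsTriangulation T)
    (hφ : IsReduction T φ) {G : Finset (Edge n)} (hG : G ∈ reducedComplex n) :
    LinearIndependent ℝ (fun δ : G => facetNormal T φ δ.1) := by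
  classical
  refine linearIndepOn_finset_iff.2 fun c hc e he => ?_
  have := hφ.eq_zero_of_sum_eq_zero hn hT hG (ω := fun e => if e ∈ G then c e else 0)
    (fun e he => if_neg he) (by
      rw [← hc]
      simp only [ite_smul, zero_smul]
      rw [← Finset.sum_filter]
      simp)
  have := congrFun this e
  simpa [he] using this

theorem IsReduction.card_le (hn : 3 ≤ n) (hT : IsTriangulation T)
    (hφ : IsReduction T φ) {G : Finset (Edge n)} (hG : G ∈ reducedComplex n) :
    G.card ≤ (diagonals T).card := by
  simpa using (hφ.linearIndepOn hn hT hG).fintype_card_le_finrank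

end

/-- The projections of the generators of the irrelevant space stay independent, so the quotient by
them has dimension the number of diagonals. -/
theorem IsTriangulation.exists_isReduction (hn : 3 ≤ n) {T : Finset (Edge n)}
    (hT : IsTriangulation T) :
    ∃ φ : (T → ℝ) →ₗ[ℝ] (diagonals T → ℝ), IsReduction T φ := by
  classical
  set S : Finset (Edge n) := T.filter (fun e => ¬ Relevant e) with hS
  set L := (irrelevantSpace n).map (restrict T) with hL
  have hind : LinearIndependent ℝ (fun e : S => restrict T (ray e.1)) := by
    refine (linearIndepOn_finset_iff (v := fun e => restrict T (ray e))).2 fun c hc e he => ?_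
    set w : Edge n → ℝ := fun e => if e ∈ S then c e else 0 with hw
    have h0 : restrict T (sepVec n w) = 0 := by
      rw [← hc, sepVec_eq_sum_ray, map_sum]
      simp only [hw, ite_smul, zero_smul, map_smul, apply_ite (restrict T), map_zero]
      rw [← Finset.sum_filter]
      simp
    have hwr : relevantPart w = 0 := by
      funext f
      by_cases hf : Relevant f
      · rw [relevantPart_of_relevant w hf]
        simp [hw, hS, hf]
      · exact relevantPart_of_not_relevant w hf
    have hlam : IsLamination (0 : Edge n → ℝ) :=
      ⟨fun _ => le_rfl, fun _ _ => rfl, fun _ _ _ => Or.inl rfl⟩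
    have heq : sepVec n w = sepVec n 0 := by
      refine eq_of_eqOn_triangulation hT (sepVec_mem_PVplus_iff.2 (hwr ▸ hlam))
        hlam.sepVec_mem fun f hf => ?_
      have := congrFun h0 ⟨f, hf⟩
      simpa [restrict, LinearMap.funLeft_apply] using this
    have := congrFun (sepVec_injective hn heq) e
    simpa [hw, he] using this
  have hspan : Submodule.span ℝ (Set.range fun e : S => restrict T (ray e.1)) = L := by
    rw [hL, irrelevantSpace, Submodule.map_span]
    congr 1
    ext x
    constructor
    · rintro ⟨e, rfl⟩
      exact ⟨_, ⟨e.1, (Finset.mem_filter.1 e.2).2, rfl⟩, rfl⟩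
    · rintro ⟨_, ⟨e, he, rfl⟩, rfl⟩
      exact ⟨⟨e, Finset.mem_filter.2 ⟨hT.mem_of_not_relevant he, he⟩⟩, rfl⟩
  have hrank : Module.finrank ℝ L = S.card := by
    rw [← hspan, finrank_span_eq_card hind, Fintype.card_coe]
  have hquot : Module.finrank ℝ ((T → ℝ) ⧸ L) = Module.finrank ℝ (diagonals T → ℝ) := by
    have h1 := L.finrank_quotient_add_finrank
    have h2 : (diagonals T).card + S.card = T.card :=
      Finset.card_filter_add_card_filter_not Relevant
    simp only [Module.finrank_fintype_fun_eq_card, Fintype.card_coe] at h1 ⊢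
    omega
  refine ⟨(LinearEquiv.ofFinrankEq _ _ hquot).toLinearMap ∘ₗ L.mkQ, ?_, ?_⟩
  · exact (LinearEquiv.surjective _).comp L.mkQ_surjective
  · rw [LinearEquiv.ker_comp, Submodule.ker_mkQ]

/-- The fan triangulation: all sides and all edges at the vertex `0`. -/
theorem fan_isTriangulation (n : ℕ) :
    IsTriangulation (Finset.univ.filter fun e : Edge n => ¬ Relevant e ∨ (e.1.1 : ℕ) = 0) := by
  refine ⟨fun e he f hf hef => ?_, fun G hG hle e he => ?_⟩
  · rw [Finset.mem_filter] at he hf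
    rcases he.2 with h | h
    · exact not_crosses_of_not_relevant h hef
    · rcases hf.2 with h' | h'
      · exact not_crosses_of_not_relevant h' hef.symm
      · simp only [Crosses, Fin.lt_def] at hef
        omega
  · rw [Finset.mem_filter]
    refine ⟨Finset.mem_univ e, ?_⟩
    by_contra! h
    obtain ⟨⟨h1, h2⟩, h3⟩ := h
    have := e.1.2.2
    have hn' : 0 < (e.1.1 : ℕ) + 1 := by omega
    let f : Edge n := ⟨(⟨0, by omega⟩, ⟨e.1.1 + 1, by omega⟩), Fin.lt_def.2 hn'⟩
    have hf : f ∈ G := hle (Finset.mem_filter.2 ⟨Finset.mem_univ f, Or.inr rfl⟩)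
    refine hG f hf e he (Or.inl ?_)
    simp only [f, Fin.lt_def]
    omega

theorem card_diagonals_fan (hn : 3 ≤ n) :
    (diagonals (Finset.univ.filter fun e : Edge n => ¬ Relevant e ∨ (e.1.1 : ℕ) = 0)).card + 3
      = n := by
  have hmem : ∀ e : Edge n, e ∈ diagonals (Finset.univ.filter fun e : Edge n =>
      ¬ Relevant e ∨ (e.1.1 : ℕ) = 0) ↔ (e.1.1 : ℕ) = 0 ∧ Relevant e := by
    intro e
    rw [diagonals, Finset.mem_filter, Finset.mem_filter]
    have := Finset.mem_univ e
    tauto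
  have h : (diagonals (Finset.univ.filter fun e : Edge n =>
      ¬ Relevant e ∨ (e.1.1 : ℕ) = 0)).card = (Finset.Ico 2 (n - 1)).card := by
    refine Finset.card_bij (fun e _ => (e.1.2 : ℕ)) ?_ ?_ ?_
    · intro e he
      rw [hmem] at he
      simp only [Relevant, Finset.mem_Ico] at he ⊢
      omega
    · intro e he f hf hef
      simp only [hmem] at he hf
      simp only [Subtype.ext_iff, Prod.ext_iff, Fin.ext_iff]
      omega
    · intro m hm
      rw [Finset.mem_Ico] at hm
      refine ⟨⟨(⟨0, by omega⟩, ⟨m, by omega⟩), Fin.lt_def.2 (show 0 < m by omega)⟩, ?_, rfl⟩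
      rw [hmem]
      simp only [Relevant, true_and]
      omega
  rw [h, Nat.card_Ico]
  omega

/-- All triangulations have the same number of diagonals, since the facet normals of each are
independent in the space attached to any other. -/
theorem IsTriangulation.card_diagonals (hn : 3 ≤ n) {T : Finset (Edge n)}
    (hT : IsTriangulation T) : (diagonals T).card + 3 = n := by
  have h0 := fan_isTriangulation n
  obtain ⟨φ, hφ⟩ := hT.exists_isReduction hn
  obtain ⟨ψ, hψ⟩ := h0.exists_isReduction hn
  have h1 := hφ.card_le hn hT h0.diagonals_mem
  have h2 := hψ.card_le hn h0 hT.diagonals_mem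
  have h3 := card_diagonals_fan hn
  omega

/-! ### Rotation -/

theorem finRotate_symm_val (a : Fin n) :
    (((finRotate n).symm a : Fin n) : ℕ) = if (a : ℕ) = 0 then n - 1 else (a : ℕ) - 1 := by
  obtain ⟨c, rfl⟩ := (finRotate n).surjective a
  rw [Equiv.symm_apply_apply]
  cases n with
  | zero => exact c.elim0
  | succ m =>
    rw [coe_finRotate]
    split_ifs <;> simp_all

theorem rotate_vals (e : Edge n) :
    (0 < (e.1.1 : ℕ) ∧ (e.rotate.1.1 : ℕ) + 1 = e.1.1 ∧ (e.rotate.1.2 : ℕ) + 1 = e.1.2) ∨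
    ((e.1.1 : ℕ) = 0 ∧ (e.rotate.1.1 : ℕ) + 1 = e.1.2 ∧ (e.rotate.1.2 : ℕ) + 1 = n) := by
  have h1 := finRotate_symm_val e.1.1
  have h2 := finRotate_symm_val e.1.2
  have h3 : (e.1.1 : ℕ) < e.1.2 := e.2
  have h4 := e.1.2.2
  have hmin : (e.rotate.1.1 : ℕ) = min (((finRotate n).symm e.1.1 : Fin n) : ℕ)
      ((finRotate n).symm e.1.2 : Fin n) := Fin.coe_min _ _
  have hmax : (e.rotate.1.2 : ℕ) = max (((finRotate n).symm e.1.1 : Fin n) : ℕ)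
      ((finRotate n).symm e.1.2 : Fin n) := Fin.coe_max _ _
  rw [h1, h2] at hmin hmax
  split_ifs at hmin hmax <;> omega

theorem Relevant.rotate {e : Edge n} (he : Relevant e) : Relevant e.rotate := by
  have h1 := rotate_vals e
  have h2 := e.1.2.2
  simp only [Relevant] at *
  omega

theorem Relevant.crosses_rotate {e : Edge n} (he : Relevant e) : Crosses e e.rotate := by
  have h1 := rotate_vals e
  have h2 := e.1.2.2
  simp only [Relevant, Crosses, Fin.lt_def] at *
  omega

section

variable {T : Finset (Edge n)} {φ : (T → ℝ) →ₗ[ℝ] (diagonals T → ℝ)}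

/-- For a diagonal of the seed triangulation, its crossing with the rotated diagonal resolves into
two sides of the polygon. -/
theorem IsReduction.facetNormal_rotate (hT : IsTriangulation T) (hφ : IsReduction T φ)
    {δ : Edge n} (hδ : δ ∈ diagonals T) : facetNormal T φ δ.rotate = -facetNormal T φ δ := by
  obtain ⟨hδT, hδr⟩ := Finset.mem_filter.1 hδ
  have hv := rotate_vals δ
  have hc : ∀ s ∈ T, ¬ Crosses δ s := fun s hs => hT.prop δ hδT s hs
  suffices h : ∃ g h : Edge n, ¬ Relevant g ∧ ¬ Relevant h ∧
      ∀ s ∈ T, sep δ s + sep δ.rotate s = sep g s + sep h s by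
    obtain ⟨g, h, hg, hh, H⟩ := h
    have := facetNormal_add_eq (φ := φ) H
    rw [hφ.facetNormal_of_not_relevant hg, hφ.facetNormal_of_not_relevant hh, add_zero] at this
    exact eq_neg_of_add_eq_zero_right this
  obtain ⟨⟨x, y⟩, hxy⟩ := δ
  generalize Edge.rotate _ = δ' at *
  obtain ⟨⟨x', y'⟩, hxy'⟩ := δ'
  have hyn := y.2
  simp only [Relevant] at hδr
  rcases hv with ⟨h1, h2, h3⟩ | ⟨h1, h2, h3⟩ <;> simp only at h1 h2 h3
  · have k1 : x' < x := Fin.lt_def.2 (by omega)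
    have k2 : x < y' := Fin.lt_def.2 (by omega)
    have k3 : y' < y := Fin.lt_def.2 (by omega)
    refine ⟨⟨(x', x), k1⟩, ⟨(y', y), k3⟩, ?_, ?_, fun s hs => ?_⟩
    · simp only [Relevant]; omega
    · simp only [Relevant]; omega
    · rw [add_comm]
      refine (Assoc.sep_resolution k1 k2 k3 s).1.resolve_right fun h => hc s hs ?_
      simp only [Crosses, Fin.lt_def, Fin.le_def] at h ⊢
      omega
  · have k1 : x < x' := Fin.lt_def.2 (by omega)
    have k2 : x' < y := Fin.lt_def.2 (by omega)
    have k3 : y < y' := Fin.lt_def.2 (by omega)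
    refine ⟨⟨(x, y'), k1.trans (k2.trans k3)⟩, ⟨(x', y), k2⟩, ?_, ?_, fun s hs => ?_⟩
    · simp only [Relevant]; omega
    · simp only [Relevant]; omega
    · refine (Assoc.sep_resolution k1 k2 k3 s).2.resolve_right fun h => hc s hs ?_
      have := s.1.2.2
      simp only [Crosses, Fin.lt_def, Fin.le_def] at h ⊢
      omega

theorem IsTriangulation.eq_of_pair_rotate_eq (hT : IsTriangulation T) {δ δ' : Edge n}
    (hδ : δ ∈ diagonals T) (hδ' : δ' ∈ diagonals T)
    (h : ({δ, δ.rotate} : Set (Edge n)) = {δ', δ'.rotate}) : δ = δ' := by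
  have h1 : δ' ∈ ({δ, δ.rotate} : Set (Edge n)) := h ▸ Set.mem_insert _ _
  rcases h1 with h1 | h1
  · exact h1.symm
  · rw [Set.mem_singleton_iff] at h1
    obtain ⟨hδT, hδr⟩ := Finset.mem_filter.1 hδ
    exact absurd hδr.crosses_rotate
      (hT.prop δ hδT _ (h1 ▸ (Finset.mem_filter.1 hδ').1))

/-! ### Laminations of minimal cost -/

theorem IsReduction.span_eq_top (hn : 3 ≤ n) (hT : IsTriangulation T) (hφ : IsReduction T φ)
    {T' : Finset (Edge n)} (hT' : IsTriangulation T') :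
    Submodule.span ℝ (Set.range fun δ : diagonals T' => facetNormal T φ δ.1) = ⊤ := by
  refine (hφ.linearIndepOn hn hT hT'.diagonals_mem).span_eq_top_of_card_eq_finrank' ?_
  have h1 := hT.card_diagonals hn
  have h2 := hT'.card_diagonals hn
  simp only [Module.finrank_fintype_fun_eq_card, Fintype.card_coe]
  omega

theorem IsReduction.exists_sum_eq (hn : 3 ≤ n) (hT : IsTriangulation T) (hφ : IsReduction T φ)
    {T' : Finset (Edge n)} (hT' : IsTriangulation T') (c : diagonals T → ℝ) :
    ∃ ω : Edge n → ℝ, (∀ e, e ∉ diagonals T' → ω e = 0) ∧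
      ∑ e, ω e • facetNormal T φ e = c := by
  classical
  have hcm : c ∈ Submodule.span ℝ (Set.range fun δ : diagonals T' => facetNormal T φ δ.1) :=
    hφ.span_eq_top hn hT hT' ▸ Submodule.mem_top
  obtain ⟨a, ha⟩ := (Submodule.mem_span_range_iff_exists_fun ℝ).1 hcm
  refine ⟨fun e => if h : e ∈ diagonals T' then a ⟨e, h⟩ else 0,
    fun e he => dif_neg he, ?_⟩
  rw [← ha, ← Finset.sum_subset (Finset.subset_univ (diagonals T'))
    (fun e _ he => by simp [he]), ← Finset.sum_coe_sort (diagonals T')]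
  exact Finset.sum_congr rfl fun e _ => by simp

/-- The facet normals span positively, since those of the diagonals of the seed triangulation are
a basis and their negatives are facet normals as well. -/
theorem IsReduction.exists_nonneg_sum_eq (hn : 3 ≤ n) (hT : IsTriangulation T)
    (hφ : IsReduction T φ) (c : diagonals T → ℝ) :
    ∃ p : Edge n → ℝ, (∀ e, 0 ≤ p e) ∧ ∑ e, p e • facetNormal T φ e = c := by
  classical
  obtain ⟨ω, hω, hc⟩ := hφ.exists_sum_eq hn hT hT c
  refine ⟨∑ δ, (max (ω δ) 0 • Pi.single δ (1 : ℝ) + max (-ω δ) 0 • Pi.single δ.rotate (1 : ℝ)),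
    fun e => ?_, ?_⟩
  · rw [Finset.sum_apply]
    refine Finset.sum_nonneg fun δ _ => ?_
    have : ∀ δ : Edge n, 0 ≤ (Pi.single δ 1 : Edge n → ℝ) e := fun δ => by
      rw [Pi.single_apply]; split_ifs <;> norm_num
    simp only [Pi.add_apply, Pi.smul_apply, smul_eq_mul]
    have := this δ
    have := ‹∀ δ : Edge n, 0 ≤ (Pi.single δ 1 : Edge n → ℝ) e› δ.rotate
    positivity
  · rw [← proj_sepVec, map_sum, map_sum, ← hc]
    refine Finset.sum_congr rfl fun δ _ => ?_
    simp only [map_add, map_smul]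
    change max (ω δ) 0 • facetNormal T φ δ + max (-ω δ) 0 • facetNormal T φ δ.rotate = _
    by_cases hδ : δ ∈ diagonals T
    · rw [hφ.facetNormal_rotate hT hδ, smul_neg, ← sub_eq_add_neg, ← sub_smul]
      congr 1
      rcases le_total (ω δ) 0 with h | h <;> simp [h]
    · simp [hω δ hδ]

/-- Nonnegative weights on the diagonals that are not a lamination can be made cheaper by
resolving a crossing, without changing the vector they represent. -/
theorem IsReduction.exists_cost_lt (hT : IsTriangulation T) (hφ : IsReduction T φ)
    {p : Edge n → ℝ} (hp : ∀ e, 0 ≤ p e) (hpr : ∀ e, ¬ Relevant e → p e = 0)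
    (hlam : ¬ IsLamination p) :
    ∃ q : Edge n → ℝ, (∀ e, 0 ≤ q e) ∧ (∀ e, ¬ Relevant e → q e = 0) ∧
      ∑ e, q e • facetNormal T φ e = ∑ e, p e • facetNormal T φ e ∧
      ∑ e, q e * rhs e < ∑ e, p e * rhs e := by
  classical
  have : ∃ e f, Crosses e f ∧ p e ≠ 0 ∧ p f ≠ 0 := by
    by_contra! h
    exact hlam ⟨hp, hpr, fun e f hef => or_iff_not_imp_left.2 fun he => h e f hef he⟩
  obtain ⟨e, f, hef, he, hf⟩ := this
  have hne : e ≠ f := by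
    rintro rfl
    simp only [Crosses, Fin.lt_def] at hef
    omega
  obtain ⟨g, h, hgh, hlt⟩ := hT.prop.facetNormal_resolution (φ := φ) hef
  set ε := min (p e) (p f) with hε
  have hε0 : 0 < ε := lt_min ((hp e).lt_of_ne' he) ((hp f).lt_of_ne' hf)
  set u : Edge n → ℝ := p + (ε • (Pi.single g 1 + Pi.single h 1)
    - ε • (Pi.single e 1 + Pi.single f 1)) with hu
  have hsum : ∑ x, u x • facetNormal T φ x = ∑ x, p x • facetNormal T φ x := by
    rw [← proj_sepVec, ← proj_sepVec, hu, map_add, map_add, add_eq_left, map_sub, map_sub,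
      map_smul, map_smul, map_smul, map_smul, map_add, map_add, map_add, map_add]
    change ε • (facetNormal T φ g + facetNormal T φ h)
      - ε • (facetNormal T φ e + facetNormal T φ f) = 0
    rw [hgh, sub_self]
  have hs : ∀ a : Edge n, ∑ x, (Pi.single a 1 : Edge n → ℝ) x * rhs x = rhs a := fun a => by
    simp [Pi.single_apply]
  have hcost : ∑ x, u x * rhs x = ∑ x, p x * rhs x
      + ε * ((rhs g + rhs h) - (rhs e + rhs f)) := by
    rw [← hs e, ← hs f, ← hs g, ← hs h]
    simp only [hu, Pi.add_apply, Pi.sub_apply, Pi.smul_apply, smul_eq_mul,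
      ← Finset.sum_add_distrib, ← Finset.sum_sub_distrib, Finset.mul_sum]
    exact Finset.sum_congr rfl fun x _ => by ring
  have hu0 : ∀ x, 0 ≤ u x := by
    intro x
    have hg : 0 ≤ (Pi.single g 1 : Edge n → ℝ) x := by
      rw [Pi.single_apply]; split_ifs <;> norm_num
    have hh : 0 ≤ (Pi.single h 1 : Edge n → ℝ) x := by
      rw [Pi.single_apply]; split_ifs <;> norm_num
    have hx : ε * ((Pi.single e 1 : Edge n → ℝ) x + (Pi.single f 1 : Edge n → ℝ) x) ≤ p x := by
      rcases eq_or_ne x e with rfl | hxe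
      · simp [hne, hε]
      · rcases eq_or_ne x f with rfl | hxf
        · simp [hne.symm, hε]
        · simpa [Pi.single_apply, hxe, hxf] using hp x
    simp only [hu, Pi.add_apply, Pi.sub_apply, Pi.smul_apply, smul_eq_mul]
    have := mul_nonneg hε0.le (add_nonneg hg hh)
    linarith
  refine ⟨relevantPart u, fun x => ?_, fun x hx => relevantPart_of_not_relevant u hx,
    (hφ.sum_relevantPart u).trans hsum, ?_⟩
  · rw [relevantPart]; split_ifs
    · exact hu0 x
    · exact le_rfl
  · refine lt_of_le_of_lt (Finset.sum_le_sum fun x _ => ?_) (lt_of_eq_of_lt hcost ?_)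
    · refine mul_le_mul_of_nonneg_right ?_ (rhs_pos x).le
      rw [relevantPart]; split_ifs
      · exact le_rfl
      · exact hu0 x
    · nlinarith

/-- Among the nonnegative weights on the diagonals that represent the same vector there is a
lamination, of no larger cost: the minimum of the cost is attained by compactness, and only at
laminations. -/
theorem IsReduction.exists_lamination_le (hT : IsTriangulation T) (hφ : IsReduction T φ)
    {p : Edge n → ℝ} (hp : ∀ e, 0 ≤ p e) (hpr : ∀ e, ¬ Relevant e → p e = 0) :
    ∃ q : Edge n → ℝ, IsLamination q ∧
      ∑ e, q e • facetNormal T φ e = ∑ e, p e • facetNormal T φ e ∧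
      ∑ e, q e * rhs e ≤ ∑ e, p e * rhs e := by
  set M := ∑ e, p e * rhs e with hM
  set K : Set (Edge n → ℝ) := {q | (∀ e, 0 ≤ q e) ∧ (∀ e, ¬ Relevant e → q e = 0) ∧
    ∑ e, q e • facetNormal T φ e = ∑ e, p e • facetNormal T φ e ∧ ∑ e, q e * rhs e ≤ M} with hK
  have hclosed : IsClosed K := by
    simp only [hK, Set.ofPred_and, Set.ofPred_forall]
    refine (isClosed_iInter fun e => isClosed_le continuous_const (continuous_apply e)).inter
      ((isClosed_iInter fun e => isClosed_iInter fun _ =>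
        isClosed_eq (continuous_apply e) continuous_const).inter
      ((isClosed_eq (by fun_prop) continuous_const).inter
        (isClosed_le (by fun_prop) continuous_const)))
  have hcompact : IsCompact K := by
    refine (isCompact_Icc (a := (0 : Edge n → ℝ)) (b := fun e => M / rhs e)).of_isClosed_subset
      hclosed fun q hq => ⟨hq.1, fun e => ?_⟩
    rw [le_div_iff₀ (rhs_pos e)]
    exact (Finset.single_le_sum (f := fun e => q e * rhs e)
      (fun e _ => mul_nonneg (hq.1 e) (rhs_pos e).le) (Finset.mem_univ e)).trans hq.2.2.2
  obtain ⟨q, hq, hmin⟩ := hcompact.exists_isMinOn ⟨p, hp, hpr, rfl, le_rfl⟩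
    (f := fun q => ∑ e, q e * rhs e) (by fun_prop)
  refine ⟨q, ?_, hq.2.2.1, hq.2.2.2⟩
  by_contra hlam
  obtain ⟨r, hr0, hrr, hrs, hrc⟩ := hφ.exists_cost_lt hT hq.1 hq.2.1 hlam
  exact absurd (hmin ⟨hr0, hrr, hrs.trans hq.2.2.1, hrc.le.trans hq.2.2.2⟩) (not_le.2 hrc)

/-- The cones over laminations cover the whole space. -/
theorem IsReduction.exists_lamination (hn : 3 ≤ n) (hT : IsTriangulation T)
    (hφ : IsReduction T φ) (c : diagonals T → ℝ) :
    ∃ q : Edge n → ℝ, IsLamination q ∧ ∑ e, q e • facetNormal T φ e = c := by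
  obtain ⟨p, hp, hc⟩ := hφ.exists_nonneg_sum_eq hn hT c
  obtain ⟨q, hq, hqp, -⟩ := hφ.exists_lamination_le hT (p := relevantPart p)
    (fun x => by rw [relevantPart]; split_ifs; exacts [hp x, le_rfl])
    (fun x hx => relevantPart_of_not_relevant p hx)
  exact ⟨q, hq, by rw [hqp, hφ.sum_relevantPart, hc]⟩

/-- A lamination is strictly cheaper than any other nonnegative weights on the diagonals that
represent the same vector. This is the strict convexity of the right-hand sides on the fan. -/
theorem IsReduction.cost_lt (hn : 3 ≤ n) (hT : IsTriangulation T) (hφ : IsReduction T φ)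
    {p q : Edge n → ℝ} (hq : IsLamination q) (hp : ∀ e, 0 ≤ p e)
    (hpr : ∀ e, ¬ Relevant e → p e = 0) (hne : p ≠ q)
    (h : ∑ e, q e • facetNormal T φ e = ∑ e, p e • facetNormal T φ e) :
    ∑ e, q e * rhs e < ∑ e, p e * rhs e := by
  by_cases hlam : IsLamination p
  · exact absurd (hφ.lamination_unique hn hT hlam hq h.symm) hne
  · obtain ⟨r, hr0, hrr, hrs, hrc⟩ := hφ.exists_cost_lt hT hp hpr hlam
    obtain ⟨m, hm, hmr, hmc⟩ := hφ.exists_lamination_le hT hr0 hrr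
    rw [← hφ.lamination_unique hn hT hm hq (hmr.trans (hrs.trans h.symm))]
    exact hmc.trans_lt hrc

/-- The wall-crossing inequalities: in a dependence that is positive at both exchanged diagonals,
the negative part is supported on common diagonals of the two triangulations, so it is a
lamination and cheaper than the positive part. -/
theorem IsReduction.wallCrossing (hn : 3 ≤ n) (hT : IsTriangulation T) (hφ : IsReduction T φ) :
    WallCrossing (facetNormal T φ) rhs := by
  intro T₁ T₂ e₁ e₂ hT₁ hT₂ he₁ he₁' he₂ he₂' herase ω hω₁ hω₂ hsum
  classical
  set D := diagonals T₁ ∪ diagonals T₂ with hD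
  have hDmem : ∀ e, e ∈ D → Relevant e := by
    intro e he
    rcases Finset.mem_union.1 he with h | h <;> exact (Finset.mem_filter.1 h).2
  have hmem : ∀ e ∈ D, e ≠ e₂ → e ∈ T₁ := by
    intro e he hne
    rcases Finset.mem_union.1 he with h | h
    · exact (Finset.mem_filter.1 h).1
    · have : e ∈ T₂.erase e₂ := Finset.mem_erase.2 ⟨hne, (Finset.mem_filter.1 h).1⟩
      rw [← herase] at this
      exact Finset.mem_of_mem_erase this
  set p : Edge n → ℝ := fun e => if e ∈ D then max (ω e) 0 else 0 with hp
  set q : Edge n → ℝ := fun e => if e ∈ D then max (-ω e) 0 else 0 with hq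
  have hp0 : ∀ e, 0 ≤ p e := fun e => by simp only [hp]; split_ifs <;> simp
  have hq0 : ∀ e, 0 ≤ q e := fun e => by simp only [hq]; split_ifs <;> simp
  have hqT : ∀ e, q e ≠ 0 → e ∈ T₁ := by
    intro e he
    have heD : e ∈ D := by
      by_contra h
      exact he (if_neg h)
    refine hmem e heD ?_
    rintro rfl
    exact he (by simp [hq, heD, hω₂.le])
  have hqlam : IsLamination q := by
    refine ⟨hq0, fun e he => if_neg fun h => he (hDmem e h), fun e f hef => ?_⟩
    by_contra! hne
    exact hT₁.prop e (hqT e hne.1) f (hqT f hne.2) hef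
  have hdiff : ∀ e, p e - q e = if e ∈ D then ω e else 0 := by
    intro e
    simp only [hp, hq]
    split_ifs
    · rcases le_total (ω e) 0 with h | h <;> simp [h]
    · simp
  have heq : ∑ e, q e • facetNormal T φ e = ∑ e, p e • facetNormal T φ e := by
    rw [eq_comm, ← sub_eq_zero, ← Finset.sum_sub_distrib, ← hsum]
    simp only [← sub_smul, hdiff, ite_smul, zero_smul]
    rw [← Finset.sum_filter]
    simp
  have hne : p ≠ q := by
    intro h
    have he₁r : Relevant e₁ := by
      by_contra h
      exact he₁' (hT₂.mem_of_not_relevant h)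
    have he₁D : e₁ ∈ D := Finset.mem_union_left _ (Finset.mem_filter.2 ⟨he₁, he₁r⟩)
    have := hdiff e₁
    rw [h, sub_self, if_pos he₁D] at this
    exact hω₁.ne this
  have hlt := hφ.cost_lt hn hT hqlam hp0 (fun e he => if_neg fun h => he (hDmem e h)) hne heq
  rw [← sub_pos, ← Finset.sum_sub_distrib] at hlt
  simp only [← sub_mul, hdiff, ite_mul, zero_mul] at hlt
  rwa [← Finset.sum_filter, Finset.filter_mem_eq_inter, Finset.univ_inter] at hlt

end

/-! ### The polytope -/

/-- Every linear functional on a coordinate space is the dot product with a vector. -/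
theorem exists_dotProduct_eq {ι : Type*} [Fintype ι] (l : (ι → ℝ) →ₗ[ℝ] ℝ) :
    ∃ X : ι → ℝ, ∀ c, dotProduct c X = l c := by
  classical
  exact ⟨fun i => l fun j => if i = j then 1 else 0, fun c =>
    (LinearMap.pi_apply_eq_sum_univ l c).symm⟩

theorem sum_smul_dotProduct {ι : Type*} [Fintype ι] (w : Edge n → ℝ) (N : Edge n → ι → ℝ)
    (X : ι → ℝ) : dotProduct (∑ e, w e • N e) X = ∑ e, w e * dotProduct (N e) X := by
  simp [sum_dotProduct, smul_dotProduct]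

theorem continuous_dotProduct_left {ι : Type*} [Fintype ι] (c : ι → ℝ) :
    Continuous fun X : ι → ℝ => dotProduct c X := by
  unfold dotProduct
  fun_prop

/-- The diagonals carrying a weight. -/
noncomputable def weightSupport (w : Edge n → ℝ) : Finset (Edge n) :=
  Finset.univ.filter fun e => w e ≠ 0

theorem mem_weightSupport {w : Edge n → ℝ} {e : Edge n} : e ∈ weightSupport w ↔ w e ≠ 0 := by
  simp [weightSupport]

theorem IsLamination.weightSupport_mem {w : Edge n → ℝ} (hw : IsLamination w) :
    weightSupport w ∈ reducedComplex n := by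
  refine ⟨fun e he f hf hef => ?_, fun e he => ?_⟩
  · exact (hw.noncrossing e f hef).elim (mem_weightSupport.1 he) (mem_weightSupport.1 hf)
  · by_contra h
    exact mem_weightSupport.1 he (hw.support e h)

/-- The indicator of a set of pairwise non-crossing diagonals is a lamination. -/
theorem exists_lamination_weightSupport_eq {G : Finset (Edge n)} (hG : G ∈ reducedComplex n) :
    ∃ w : Edge n → ℝ, IsLamination w ∧ weightSupport w = G := by
  classical
  refine ⟨fun e => if e ∈ G then 1 else 0, ⟨fun e => ?_, fun e he => ?_, fun e f hef => ?_⟩, ?_⟩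
  · split_ifs <;> norm_num
  · exact if_neg fun h => he (hG.2 e h)
  · by_contra! h
    have he : e ∈ G := by by_contra h'; exact h.1 (if_neg h')
    have hf : f ∈ G := by by_contra h'; exact h.2 (if_neg h')
    exact hG.1 e he f hf hef
  · ext e
    simp [mem_weightSupport]

section

variable {T : Finset (Edge n)} {φ : (T → ℝ) →ₗ[ℝ] (diagonals T → ℝ)}

theorem IsReduction.exists_dotProduct_eq_on (hn : 3 ≤ n) (hT : IsTriangulation T)
    (hφ : IsReduction T φ) {T' : Finset (Edge n)} (hT' : IsTriangulation T')
    (val : Edge n → ℝ) :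
    ∃ X : diagonals T → ℝ, ∀ e ∈ diagonals T', dotProduct (facetNormal T φ e) X = val e := by
  let b := Module.Basis.mk (hφ.linearIndepOn hn hT hT'.diagonals_mem)
    (hφ.span_eq_top hn hT hT').ge
  obtain ⟨X, hX⟩ := exists_dotProduct_eq (b.constr ℝ fun δ : diagonals T' => val δ.1)
  refine ⟨X, fun e he => ?_⟩
  have : facetNormal T φ e = b ⟨e, he⟩ := by simp [b]
  rw [this, hX, Module.Basis.constr_basis]

/-- The point where the inequalities of the diagonals of a triangulation are tight satisfies all
other inequalities strictly. -/
theorem IsReduction.dotProduct_lt (hn : 3 ≤ n) (hT : IsTriangulation T)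
    (hφ : IsReduction T φ) {T' : Finset (Edge n)} (hT' : IsTriangulation T')
    {X : diagonals T → ℝ} (hX : ∀ e ∈ diagonals T', dotProduct (facetNormal T φ e) X = rhs e)
    {f : Edge n} (hf : Relevant f) (hfT : f ∉ T') :
    dotProduct (facetNormal T φ f) X < rhs f := by
  classical
  obtain ⟨ω, hω, hsum⟩ := hφ.exists_sum_eq hn hT hT' (facetNormal T φ f)
  have hωf : ω f = 0 := hω f fun h => hfT (Finset.mem_filter.1 h).1
  set q : Edge n → ℝ := fun e => max (ω e) 0 with hq
  -- moving the negative coefficients to the other side compares `f` with a lamination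
  set p : Edge n → ℝ := fun e => max (-ω e) 0 + if e = f then 1 else 0 with hp
  have hqp : ∀ e, q e - p e = ω e - if e = f then 1 else 0 := by
    intro e
    simp only [hq, hp]
    rcases le_total (ω e) 0 with h | h
    · simp only [max_eq_right h, max_eq_left (neg_nonneg.2 h)]; ring
    · simp only [max_eq_left h, max_eq_right (neg_nonpos.2 h)]; ring
  have hqsupp : ∀ e, q e ≠ 0 → e ∈ diagonals T' := by
    intro e he
    by_contra h
    exact he (by simp [hq, hω e h])
  have hqlam : IsLamination q := by
    refine ⟨fun e => le_max_right _ _, fun e he => ?_, fun e g heg => ?_⟩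
    · by_contra h
      exact he (Finset.mem_filter.1 (hqsupp e h)).2
    · by_contra! h
      exact hT'.diagonals_mem.1 e (hqsupp e h.1) g (hqsupp g h.2) heg
  have hp0 : ∀ e, 0 ≤ p e := fun e =>
    add_nonneg (le_max_right _ _) (by split_ifs <;> norm_num)
  have hpr : ∀ e, ¬ Relevant e → p e = 0 := by
    intro e he
    have h1 : ω e = 0 := hω e fun h => he (Finset.mem_filter.1 h).2
    have h2 : e ≠ f := fun h => he (h ▸ hf)
    simp [hp, h1, h2]
  have hne : p ≠ q := by
    intro h
    have := hqp f
    simp [h, hωf] at this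
  have heq : ∑ e, q e • facetNormal T φ e = ∑ e, p e • facetNormal T φ e := by
    rw [← sub_eq_zero, ← Finset.sum_sub_distrib]
    simp only [← sub_smul, hqp]
    simp [sub_smul, hsum]
  have hlt := hφ.cost_lt hn hT hqlam hp0 hpr hne heq
  rw [← sub_neg, ← Finset.sum_sub_distrib] at hlt
  simp only [← sub_mul, hqp] at hlt
  have hω' : ∑ e, ω e * rhs e = dotProduct (facetNormal T φ f) X := by
    rw [← hsum, sum_smul_dotProduct]
    refine Finset.sum_congr rfl fun e _ => ?_
    by_cases he : e ∈ diagonals T'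
    · rw [hX e he]
    · simp [hω e he]
  simp only [sub_mul, Finset.sum_sub_distrib, hω', ite_mul, one_mul, zero_mul,
    Finset.sum_ite_eq', Finset.mem_univ, if_true] at hlt
  linarith

/-- For every set of pairwise non-crossing diagonals there is a point of the polytope at which
exactly the inequalities of this set are tight. -/
theorem IsReduction.exists_tight (hn : 3 ≤ n) (hT : IsTriangulation T)
    (hφ : IsReduction T φ) {G : Finset (Edge n)} (hG : G ∈ reducedComplex n) :
    ∃ X ∈ polyhedron (facetNormal T φ) rhs,
      ∀ e, Relevant e → (dotProduct (facetNormal T φ e) X = rhs e ↔ e ∈ G) := by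
  classical
  obtain ⟨T', hGT, hT'⟩ := exists_isTriangulation_ge hG.1
  obtain ⟨X, hX⟩ := hφ.exists_dotProduct_eq_on hn hT hT' rhs
  -- `Z` points away from the facets of the diagonals of `T'` outside `G`
  obtain ⟨Z, hZ⟩ := hφ.exists_dotProduct_eq_on hn hT hT' fun e => if e ∈ G then 0 else 1
  have hsmall : ∀ᶠ ε in nhdsWithin (0 : ℝ) (Set.Ioi 0), ∀ f : Edge n, Relevant f → f ∉ T' →
      dotProduct (facetNormal T φ f) X - ε * dotProduct (facetNormal T φ f) Z < rhs f := by
    refine Filter.eventually_all.2 fun f => ?_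
    by_cases hf : Relevant f
    · by_cases hfT : f ∈ T'
      · exact Filter.Eventually.of_forall fun ε _ h => absurd hfT h
      · have hlt := hφ.dotProduct_lt hn hT hT' hX hf hfT
        have hcont : Continuous fun ε : ℝ =>
            dotProduct (facetNormal T φ f) X - ε * dotProduct (facetNormal T φ f) Z := by
          fun_prop
        have := (hcont.tendsto 0).eventually_lt_const (u := rhs f) (by simpa using hlt)
        exact (this.filter_mono nhdsWithin_le_nhds).mono fun ε h _ _ => h
    · exact Filter.Eventually.of_forall fun ε h => absurd h hf
  obtain ⟨ε, hε, hε0⟩ := (hsmall.and self_mem_nhdsWithin).exists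
  have hε0 : 0 < ε := hε0
  have hdot : ∀ e, dotProduct (facetNormal T φ e) (X - ε • Z)
      = dotProduct (facetNormal T φ e) X - ε * dotProduct (facetNormal T φ e) Z := fun e => by
    rw [dotProduct_sub, dotProduct_smul, smul_eq_mul]
  have key : ∀ e, Relevant e → dotProduct (facetNormal T φ e) (X - ε • Z) ≤ rhs e ∧
      (dotProduct (facetNormal T φ e) (X - ε • Z) = rhs e ↔ e ∈ G) := by
    intro e he
    rw [hdot]
    by_cases heT : e ∈ T'
    · have hed : e ∈ diagonals T' := Finset.mem_filter.2 ⟨heT, he⟩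
      rw [hX e hed, hZ e hed]
      by_cases heG : e ∈ G
      · simp [heG]
      · simp [heG, hε0.le, hε0.ne']
    · have := hε e he heT
      exact ⟨this.le, fun h => absurd h this.ne, fun h => absurd (hGT h) heT⟩
  exact ⟨X - ε • Z, fun e he => (key e he).1, fun e he => (key e he).2⟩

theorem IsLamination.dotProduct_le {q : Edge n → ℝ} (hq : IsLamination q) {X : diagonals T → ℝ}
    (hX : X ∈ polyhedron (facetNormal T φ) rhs) :
    dotProduct (∑ e, q e • facetNormal T φ e) X ≤ ∑ e, q e * rhs e := by
  rw [sum_smul_dotProduct]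
  refine Finset.sum_le_sum fun e _ => ?_
  by_cases he : Relevant e
  · exact mul_le_mul_of_nonneg_left (hX e he) (hq.nonneg e)
  · simp [hq.support e he]

theorem IsLamination.dotProduct_eq_iff {q : Edge n → ℝ} (hq : IsLamination q)
    {X : diagonals T → ℝ} (hX : X ∈ polyhedron (facetNormal T φ) rhs) :
    dotProduct (∑ e, q e • facetNormal T φ e) X = ∑ e, q e * rhs e ↔
      X ∈ faceOf (facetNormal T φ) rhs (weightSupport q) := by
  have hle : ∀ e ∈ Finset.univ, q e * dotProduct (facetNormal T φ e) X ≤ q e * rhs e := by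
    intro e _
    by_cases he : Relevant e
    · exact mul_le_mul_of_nonneg_left (hX e he) (hq.nonneg e)
    · simp [hq.support e he]
  rw [sum_smul_dotProduct, Finset.sum_eq_sum_iff_of_le hle]
  constructor
  · exact fun h => ⟨hX, fun e he =>
      mul_left_cancel₀ (mem_weightSupport.1 he) (h e (Finset.mem_univ e))⟩
  · intro h e _
    by_cases he : q e = 0
    · simp [he]
    · rw [h.2 e (mem_weightSupport.2 he)]

theorem mem_faceOf_iff_subset {X : diagonals T → ℝ} {G H : Finset (Edge n)}
    (hX : X ∈ polyhedron (facetNormal T φ) rhs) (hH : ∀ e ∈ H, Relevant e)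
    (htight : ∀ e, Relevant e → (dotProduct (facetNormal T φ e) X = rhs e ↔ e ∈ G)) :
    X ∈ faceOf (facetNormal T φ) rhs H ↔ H ⊆ G :=
  ⟨fun h e he => (htight e (hH e he)).1 (h.2 e he),
    fun h => ⟨hX, fun e he => (htight e (hH e he)).2 (h he)⟩⟩

/-- A linear functional that is represented by a lamination is maximal on the polytope exactly at
the face of the support of this lamination. -/
theorem IsReduction.maximizers_eq (hn : 3 ≤ n) (hT : IsTriangulation T) (hφ : IsReduction T φ)
    {q : Edge n → ℝ} (hq : IsLamination q) :
    {X | X ∈ polyhedron (facetNormal T φ) rhs ∧ ∀ Y ∈ polyhedron (facetNormal T φ) rhs,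
      dotProduct (∑ e, q e • facetNormal T φ e) Y ≤ dotProduct (∑ e, q e • facetNormal T φ e) X}
      = faceOf (facetNormal T φ) rhs (weightSupport q) := by
  obtain ⟨X₀, hX₀, htight⟩ := hφ.exists_tight hn hT hq.weightSupport_mem
  have hX₀f := (mem_faceOf_iff_subset hX₀ hq.weightSupport_mem.2 htight).2 (le_refl _)
  have hmax := (hq.dotProduct_eq_iff hX₀).2 hX₀f
  ext X
  constructor
  · rintro ⟨hX, h⟩
    exact (hq.dotProduct_eq_iff hX).1 (le_antisymm (hq.dotProduct_le hX) (hmax ▸ h X₀ hX₀))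
  · intro hX
    exact ⟨hX.1, fun Y hY => ((hq.dotProduct_eq_iff hX.1).2 hX).symm ▸ hq.dotProduct_le hY⟩

theorem IsReduction.normalCone_faceOf (hn : 3 ≤ n) (hT : IsTriangulation T)
    (hφ : IsReduction T φ) {G : Finset (Edge n)} (hG : G ∈ reducedComplex n) :
    normalCone (polyhedron (facetNormal T φ) rhs) (faceOf (facetNormal T φ) rhs G)
      = proj T φ '' coneOf G := by
  ext c
  constructor
  · intro hc
    obtain ⟨q, hq, rfl⟩ := hφ.exists_lamination hn hT c
    obtain ⟨X, hX, htight⟩ := hφ.exists_tight hn hT hG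
    have hXG := (mem_faceOf_iff_subset hX hG.2 htight).2 (le_refl _)
    have hXq : X ∈ faceOf (facetNormal T φ) rhs (weightSupport q) :=
      hφ.maximizers_eq hn hT hq ▸ ⟨hX, hc X hXG⟩
    have hsub := (mem_faceOf_iff_subset hX hq.weightSupport_mem.2 htight).1 hXq
    refine ⟨sepVec n q, ⟨q, fun e _ => hq.nonneg e, fun e _ he => ?_, rfl⟩, proj_sepVec q⟩
    by_contra h
    exact he (hsub (mem_weightSupport.2 h))
  · rintro ⟨_, ⟨w, hw0, hwG, rfl⟩, rfl⟩ X hX Y hY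
    rw [proj_sepVec, sum_smul_dotProduct, sum_smul_dotProduct]
    refine Finset.sum_le_sum fun e _ => ?_
    by_cases he : Relevant e
    · by_cases heG : e ∈ G
      · rw [hX.2 e heG]
        exact mul_le_mul_of_nonneg_left (hY e he) (hw0 e he)
      · simp [hwG e he heG]
    · simp [hφ.facetNormal_of_not_relevant he]

theorem convex_polyhedron (N : Edge n → diagonals T → ℝ) (b : Edge n → ℝ) :
    Convex ℝ (polyhedron N b) := by
  intro X hX Y hY s t hs ht hst e he
  rw [dotProduct_add, dotProduct_smul, dotProduct_smul, smul_eq_mul, smul_eq_mul]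
  have h1 := mul_le_mul_of_nonneg_left (hX e he) hs
  have h2 := mul_le_mul_of_nonneg_left (hY e he) ht
  have h3 : s * b e + t * b e = b e := by rw [← add_mul, hst, one_mul]
  linarith

/-- The polyhedron is the convex hull of finitely many points, one with prescribed tight
inequalities for each set of non-crossing diagonals: otherwise a linear functional separates one of
its points from these, and the functional is represented by a lamination. -/
theorem IsReduction.isPolytope (hn : 3 ≤ n) (hT : IsTriangulation T) (hφ : IsReduction T φ) :
    IsPolytope (polyhedron (facetNormal T φ) rhs) := by
  choose X hX htight using fun G : reducedComplex n => hφ.exists_tight hn hT G.2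
  have hfin : (Set.range X).Finite := Set.finite_range X
  refine ⟨hfin.toFinset, ?_⟩
  rw [hfin.coe_toFinset]
  refine Set.Subset.antisymm (fun Y hY => ?_) (convexHull_min ?_ (convex_polyhedron _ _))
  · by_contra hYn
    obtain ⟨l, u, hlt, hgt⟩ := geometric_hahn_banach_closed_point (convex_convexHull ℝ _)
      (hfin.isClosed_convexHull ℝ) hYn
    obtain ⟨c, hc⟩ := exists_dotProduct_eq l.toLinearMap
    have hc' : ∀ Z, dotProduct c Z = l Z := fun Z => by rw [dotProduct_comm]; exact hc Z
    obtain ⟨q, hq, rfl⟩ := hφ.exists_lamination hn hT c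
    set G : reducedComplex n := ⟨weightSupport q, hq.weightSupport_mem⟩ with hG
    have h1 := hq.dotProduct_le hY
    rw [← (hq.dotProduct_eq_iff (hX G)).2
      ((mem_faceOf_iff_subset (hX G) G.2.2 (htight G)).2 (le_refl _)), hc', hc'] at h1
    have h2 := hlt (X G) (subset_convexHull ℝ _ (Set.mem_range_self G))
    linarith
  · rintro _ ⟨G, rfl⟩
    exact hX G

theorem IsReduction.bijOn_faceOf (hn : 3 ≤ n) (hT : IsTriangulation T) (hφ : IsReduction T φ) :
    Set.BijOn (faceOf (facetNormal T φ) rhs) (reducedComplex n)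
      (faces (polyhedron (facetNormal T φ) rhs)) := by
  refine ⟨fun G hG => ?_, fun G hG G' hG' h => ?_, fun F hF => ?_⟩
  · obtain ⟨X, hX, htight⟩ := hφ.exists_tight hn hT hG
    refine ⟨⟨X, (mem_faceOf_iff_subset hX hG.2 htight).2 (le_refl _)⟩, fun _ => ?_⟩
    obtain ⟨q, hq, rfl⟩ := exists_lamination_weightSupport_eq hG
    set c := ∑ e, q e • facetNormal T φ e with hc
    refine ⟨⟨dotProductBilin ℝ ℝ c, continuous_dotProduct_left c⟩, ?_⟩
    exact (hφ.maximizers_eq hn hT hq).symm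
  · obtain ⟨X, hX, htight⟩ := hφ.exists_tight hn hT hG
    obtain ⟨X', hX', htight'⟩ := hφ.exists_tight hn hT hG'
    refine Finset.Subset.antisymm ?_ ?_
    · rw [← mem_faceOf_iff_subset hX' hG.2 htight', h, mem_faceOf_iff_subset hX' hG'.2 htight']
    · rw [← mem_faceOf_iff_subset hX hG'.2 htight, ← h, mem_faceOf_iff_subset hX hG.2 htight]
  · obtain ⟨l, rfl⟩ := hF.2 hF.1
    obtain ⟨c, hc⟩ := exists_dotProduct_eq l.toLinearMap
    have hc' : ∀ Z, l Z = dotProduct c Z := fun Z => by rw [dotProduct_comm]; exact (hc Z).symm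
    obtain ⟨q, hq, rfl⟩ := hφ.exists_lamination hn hT c
    refine ⟨weightSupport q, hq.weightSupport_mem, ?_⟩
    rw [← hφ.maximizers_eq hn hT hq]
    simp only [hc']

theorem IsReduction.realizesAssociahedron (hn : 3 ≤ n) (hT : IsTriangulation T)
    (hφ : IsReduction T φ) : RealizesAssociahedron (facetNormal T φ) rhs := by
  refine ⟨hφ.isPolytope hn hT, ⟨0, ?_⟩, hφ.bijOn_faceOf hn hT, fun G hG G' hG' => ?_⟩
  · refine mem_interior.2 ⟨{X | ∀ e, dotProduct (facetNormal T φ e) X < rhs e},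
      fun X hX e _ => (hX e).le, ?_, fun e => by simpa using rhs_pos e⟩
    rw [Set.ofPred_forall]
    exact isOpen_iInter_of_finite fun e =>
      isOpen_lt (continuous_dotProduct_left _) continuous_const
  · obtain ⟨X, hX, htight⟩ := hφ.exists_tight hn hT hG'
    constructor
    · intro h
      exact (mem_faceOf_iff_subset hX hG.2 htight).1
        (h ((mem_faceOf_iff_subset hX hG'.2 htight).2 (le_refl _)))
    · exact fun h Y hY => ⟨hY.1, fun e he => hY.2 e (h he)⟩

end

/-! ### The cones of the fan -/

theorem coneOf_subset_PVplus {G : Finset (Edge n)} (hG : G ∈ reducedComplex n) :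
    coneOf G ⊆ PVplus n := by
  rintro _ ⟨w, hw0, hwG, rfl⟩
  refine sepVec_mem_PVplus_iff.2 ⟨fun e => ?_, fun e he => relevantPart_of_not_relevant w he,
    fun e f hef => ?_⟩
  · rw [relevantPart]
    split_ifs with h
    exacts [hw0 e h, le_rfl]
  · have hmem : ∀ e, relevantPart w e ≠ 0 → e ∈ G := by
      intro e he
      by_contra h
      refine he ?_
      by_cases her : Relevant e
      · rw [relevantPart_of_relevant w her, hwG e her h]
      · exact relevantPart_of_not_relevant w her
    by_contra! h
    exact hG.1 e (hmem e h.1) f (hmem f h.2) hef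

/-- `coneOf G` is the face of the Groebner cone on which the sum of the coefficients at the
diagonals outside `G` vanishes. -/
theorem coneOf_mem_fanPVplus (hn : 3 ≤ n) {G : Finset (Edge n)} (hG : G ∈ reducedComplex n) :
    coneOf G ∈ fanPVplus n := by
  classical
  refine ⟨⟨0, 0, by simp, by simp, by simp⟩, fun _ => ?_, coneOf_subset_PVplus hG⟩
  let d := LinearEquiv.ofBijective (sepVec n) ⟨sepVec_injective hn, sepVec_surjective hn⟩
  let S : Finset (Edge n) := Finset.univ.filter fun e => Relevant e ∧ e ∉ G
  let l : (Edge n → ℝ) →ₗ[ℝ] ℝ := -∑ e ∈ S, LinearMap.proj e ∘ₗ d.symm.toLinearMap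
  have hl : ∀ w, l (sepVec n w) = -∑ e ∈ S, w e := by
    intro w
    have : d.symm (sepVec n w) = w := d.symm_apply_apply w
    simp [l, this]
  have hnonpos : ∀ v ∈ FP n, l v ≤ 0 := by
    intro v hv
    obtain ⟨w, rfl⟩ := sepVec_surjective hn v
    rw [hl, neg_nonpos]
    exact Finset.sum_nonneg fun e he =>
      sepVec_mem_FP_iff.1 hv e (Finset.mem_filter.1 he).2.1
  refine ⟨LinearMap.toContinuousLinearMap l, ?_⟩
  ext v
  simp only [LinearMap.coe_toContinuousLinearMap']
  constructor
  · intro hv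
    refine ⟨(coneOf_subset_PVplus hG hv).2, fun y hy => ?_⟩
    obtain ⟨w, -, hwG, rfl⟩ := hv
    rw [hl, Finset.sum_eq_zero, neg_zero]
    · exact hnonpos y hy
    · exact fun e he => hwG e (Finset.mem_filter.1 he).2.1 (Finset.mem_filter.1 he).2.2
  · rintro ⟨hv, hmax⟩
    obtain ⟨w, rfl⟩ := sepVec_surjective hn v
    have hw0 := sepVec_mem_FP_iff.1 hv
    have h0 := hmax _ ((sepVec_mem_FP_iff (w := (0 : Edge n → ℝ))).2 (by simp))
    rw [map_zero, map_zero, hl, Right.nonneg_neg_iff] at h0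
    have hS : ∀ e ∈ S, 0 ≤ w e := fun e he => hw0 e (Finset.mem_filter.1 he).2.1
    have h1 := (Finset.sum_eq_zero_iff_of_nonneg hS).1
      (le_antisymm h0 (Finset.sum_nonneg hS))
    exact ⟨w, hw0, fun e he heG =>
      h1 e (Finset.mem_filter.2 ⟨Finset.mem_univ e, he, heG⟩), rfl⟩

theorem sUnion_fanPVplus (hn : 3 ≤ n) : ⋃₀ fanPVplus n = PVplus n := by
  refine Set.Subset.antisymm (Set.sUnion_subset fun F hF => hF.2.2) fun v hv => ?_
  obtain ⟨w, rfl⟩ := sepVec_surjective hn v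
  have hlam := sepVec_mem_PVplus_iff.1 hv
  refine ⟨_, coneOf_mem_fanPVplus hn hlam.weightSupport_mem, w,
    sepVec_mem_FP_iff.1 hv.2, fun e he hes => ?_, rfl⟩
  by_contra h
  exact hes (mem_weightSupport.2 (by rwa [relevantPart_of_relevant w he]))

/-- Every face of the Groebner cone inside the prevariety is the cone of a set of non-crossing
diagonals, namely of those whose generators the supporting functional annihilates. -/
theorem exists_eq_coneOf (hn : 3 ≤ n) {F : Set (Edge n → ℝ)} (hF : F ∈ fanPVplus n) :
    ∃ G ∈ reducedComplex n, F = coneOf G := by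
  classical
  obtain ⟨hne, hexp, hsub⟩ := hF
  obtain ⟨l, hl⟩ := hexp hne
  have hlsum : ∀ w, l (sepVec n w) = ∑ e, w e * l (ray e) := by
    intro w
    rw [sepVec_eq_sum_ray, map_sum]
    simp
  obtain ⟨v₀, hv₀⟩ := hne
  rw [hl] at hv₀
  obtain ⟨hv₀F, hmax⟩ := hv₀
  obtain ⟨w₀, rfl⟩ := sepVec_surjective hn v₀
  have hw₀ := sepVec_mem_FP_iff.1 hv₀F
  have hadd : ∀ (e : Edge n) (t : ℝ), (Relevant e → 0 ≤ t) → t * l (ray e) ≤ 0 := by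
    intro e t ht
    have h := hmax (sepVec n (w₀ + t • Pi.single e 1)) (sepVec_mem_FP_iff.2 fun f hf => by
      rcases eq_or_ne f e with rfl | hfe
      · simpa using add_nonneg (hw₀ f hf) (ht hf)
      · simpa [hfe] using hw₀ f hf)
    rw [map_add, map_add, map_smul, map_smul] at h
    change _ + t * l (ray e) ≤ _ at h
    linarith
  have hrel : ∀ e, Relevant e → l (ray e) ≤ 0 := fun e _ => by
    simpa using hadd e 1 fun _ => zero_le_one
  have hside : ∀ e, ¬ Relevant e → l (ray e) = 0 := fun e he => by
    have h1 := hadd e 1 fun h => absurd h he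
    have h2 := hadd e (-1) fun h => absurd h he
    linarith
  have hterm : ∀ w : Edge n → ℝ, (∀ e, Relevant e → 0 ≤ w e) →
      ∀ e ∈ Finset.univ, w e * l (ray e) ≤ 0 := by
    intro w hw e _
    by_cases he : Relevant e
    · exact mul_nonpos_of_nonneg_of_nonpos (hw e he) (hrel e he)
    · simp [hside e he]
  have hmax0 : l (sepVec n w₀) = 0 := by
    refine le_antisymm ?_ ?_
    · rw [hlsum]
      exact Finset.sum_nonpos (hterm w₀ hw₀)
    · have := hmax (sepVec n 0) (sepVec_mem_FP_iff.2 (by simp))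
      simpa using this
  have hFw : ∀ w, sepVec n w ∈ F ↔
      (∀ e, Relevant e → 0 ≤ w e) ∧ ∀ e, w e * l (ray e) = 0 := by
    intro w
    rw [hl]
    constructor
    · rintro ⟨hw, hm⟩
      rw [sepVec_mem_FP_iff] at hw
      refine ⟨hw, fun e => ?_⟩
      have h1 := hm _ hv₀F
      rw [hmax0, hlsum] at h1
      have h2 := (Finset.sum_eq_zero_iff_of_nonpos (hterm w hw)).1
        (le_antisymm (Finset.sum_nonpos (hterm w hw)) h1)
      exact h2 e (Finset.mem_univ e)
    · rintro ⟨hw, h0⟩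
      refine ⟨sepVec_mem_FP_iff.2 hw, fun y hy => ?_⟩
      rw [hlsum w, Finset.sum_eq_zero fun e _ => h0 e, ← hmax0]
      exact hmax y hy
  let G : Finset (Edge n) := Finset.univ.filter fun e => Relevant e ∧ l (ray e) = 0
  have hmemG : ∀ e, e ∈ G ↔ Relevant e ∧ l (ray e) = 0 := fun e => by simp [G]
  refine ⟨G, ⟨fun e he f hf hef => ?_, fun e he => ((hmemG e).1 he).1⟩, ?_⟩
  · have hmem : sepVec n (fun e => if e ∈ G then 1 else 0) ∈ F := by
      refine (hFw _).2 ⟨fun e _ => by split_ifs <;> norm_num, fun e => ?_⟩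
      split_ifs with h
      · rw [((hmemG e).1 h).2, mul_zero]
      · rw [zero_mul]
    have hlam := sepVec_mem_PVplus_iff.1 (hsub hmem)
    have h := hlam.noncrossing e f hef
    rw [relevantPart_of_relevant _ ((hmemG e).1 he).1,
      relevantPart_of_relevant _ ((hmemG f).1 hf).1, if_pos he, if_pos hf] at h
    simp at h
  · ext v
    obtain ⟨w, rfl⟩ := sepVec_surjective hn v
    rw [hFw]
    constructor
    · rintro ⟨hw, h0⟩
      refine ⟨w, hw, fun e he heG => ?_, rfl⟩
      exact (mul_eq_zero.1 (h0 e)).resolve_right fun h => heG ((hmemG e).2 ⟨he, h⟩)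
    · rintro ⟨u, hu, huG, huw⟩
      obtain rfl := sepVec_injective hn huw
      refine ⟨hu, fun e => ?_⟩
      by_cases he : Relevant e
      · by_cases heG : e ∈ G
        · rw [((hmemG e).1 heG).2, mul_zero]
        · rw [huG e he heG, zero_mul]
      · rw [hside e he, mul_zero]

section

variable {T : Finset (Edge n)} {φ : (T → ℝ) →ₗ[ℝ] (diagonals T → ℝ)}

theorem IsReduction.normalFan_eq (hn : 3 ≤ n) (hT : IsTriangulation T) (hφ : IsReduction T φ) :
    normalFan (polyhedron (facetNormal T φ) rhs) = projectedFan T φ := by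
  have hbij := hφ.bijOn_faceOf hn hT
  ext C
  constructor
  · rintro ⟨F, hF, rfl⟩
    obtain ⟨G, hG, rfl⟩ := hbij.surjOn hF
    exact ⟨coneOf G, coneOf_mem_fanPVplus hn hG, hφ.normalCone_faceOf hn hT hG⟩
  · rintro ⟨F, hF, rfl⟩
    obtain ⟨G, hG, rfl⟩ := exists_eq_coneOf hn hF
    exact ⟨_, hbij.mapsTo hG, (hφ.normalCone_faceOf hn hT hG).symm⟩

/-! ### Parallel facets -/

/-- If positive multiples of the normals of two crossing diagonals cancel, then resolving the
crossing leaves only sides of the polygon. This makes the one diagonal the rotation of the other,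
and it puts the latter into the seed triangulation. -/
theorem IsReduction.rotate_of_cancel (hn : 3 ≤ n) (hT : IsTriangulation T)
    (hφ : IsReduction T φ) {i k j l : Fin n} (h₁ : i < k) (h₂ : k < j) (h₃ : j < l)
    (he : Relevant (⟨(i, j), h₁.trans h₂⟩ : Edge n))
    (hf : Relevant (⟨(k, l), h₂.trans h₃⟩ : Edge n)) {s t : ℝ} (hs : 0 < s) (ht : 0 < t)
    (h : s • facetNormal T φ ⟨(i, j), h₁.trans h₂⟩
      + t • facetNormal T φ ⟨(k, l), h₂.trans h₃⟩ = 0) :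
    ∃ δ ∈ diagonals T,
      ((⟨(i, j), h₁.trans h₂⟩ : Edge n) = δ ∧ (⟨(k, l), h₂.trans h₃⟩ : Edge n) = δ.rotate) ∨
      ((⟨(i, j), h₁.trans h₂⟩ : Edge n) = δ.rotate ∧ (⟨(k, l), h₂.trans h₃⟩ : Edge n) = δ) := by
  classical
  set e : Edge n := ⟨(i, j), h₁.trans h₂⟩ with hedef
  set f : Edge n := ⟨(k, l), h₂.trans h₃⟩ with hfdef
  have main : ∀ g h' : Edge n,
      facetNormal T φ e + facetNormal T φ f = facetNormal T φ g + facetNormal T φ h' →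
      (¬ Crosses g h' ∧ ¬ Crosses e g ∧ ¬ Crosses e h' ∧ ¬ Crosses f g ∧ ¬ Crosses f h') →
      ¬ Relevant g ∧ ¬ Relevant h' := by
    intro g h' hres hnc
    have hself : ∀ a : Edge n, ¬ Crosses a a := fun a => by
      simp only [Crosses, Fin.lt_def]; omega
    have hsymm : ∀ a b : Edge n, ¬ Crosses a b → ¬ Crosses b a := fun a b h hc => h hc.symm
    set m := min s t with hm
    have hm0 : 0 < m := lt_min hs ht
    have hms : m ≤ s := min_le_left _ _
    have hmt : m ≤ t := min_le_right _ _
    set u : Edge n → ℝ := m • (Pi.single g 1 + Pi.single h' 1)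
      + ((s - m) • Pi.single e 1 + (t - m) • Pi.single f 1) with hu
    have hsum : ∑ x, u x • facetNormal T φ x = 0 := by
      rw [← proj_sepVec, hu, map_add, map_add, map_smul, map_smul, map_add, map_add, map_add,
        map_add, map_smul, map_smul, map_smul, map_smul]
      change m • (facetNormal T φ g + facetNormal T φ h')
        + ((s - m) • facetNormal T φ e + (t - m) • facetNormal T φ f) = 0
      rw [← hres, ← h]
      module
    have hsing : ∀ a x : Edge n, 0 ≤ (Pi.single a 1 : Edge n → ℝ) x := fun a x => by
      rw [Pi.single_apply]; split_ifs <;> norm_num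
    have hu0 : ∀ x, 0 ≤ u x := by
      intro x
      have h1 := mul_nonneg hm0.le (add_nonneg (hsing g x) (hsing h' x))
      have h2 := mul_nonneg (sub_nonneg.2 hms) (hsing e x)
      have h3 := mul_nonneg (sub_nonneg.2 hmt) (hsing f x)
      simp only [hu, Pi.add_apply, Pi.smul_apply, smul_eq_mul]
      linarith
    have husupp : ∀ x, u x ≠ 0 → x = g ∨ x = h' ∨ (x = e ∧ s ≠ m) ∨ (x = f ∧ t ≠ m) := by
      intro x hx
      by_contra! hne
      obtain ⟨hg, hh, he', hf'⟩ := hne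
      refine hx ?_
      have h1 : (s - m) * (Pi.single e 1 : Edge n → ℝ) x = 0 := by
        by_cases hxe : x = e
        · rw [he' hxe, sub_self, zero_mul]
        · simp [hxe]
      have h2 : (t - m) * (Pi.single f 1 : Edge n → ℝ) x = 0 := by
        by_cases hxf : x = f
        · rw [hf' hxf, sub_self, zero_mul]
        · simp [hxf]
      simp only [hu, Pi.add_apply, Pi.smul_apply, smul_eq_mul, h1, h2]
      simp [hg, hh]
    have hlam : IsLamination (relevantPart u) := by
      refine ⟨fun x => ?_, fun x hx => relevantPart_of_not_relevant u hx, fun x y hxy => ?_⟩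
      · rw [relevantPart]
        split_ifs
        exacts [hu0 x, le_rfl]
      · by_contra! hne
        have hne' : ∀ z, relevantPart u z ≠ 0 → u z ≠ 0 := by
          intro z hz h0
          refine hz ?_
          rw [relevantPart, h0, ite_self]
        have hst : ¬ (s ≠ m ∧ t ≠ m) := by
          rcases min_choice s t with h0 | h0 <;> simp [hm, h0]
        obtain ⟨n1, n2, n3, n4, n5⟩ := hnc
        rcases husupp x (hne' x hne.1) with rfl | rfl | ⟨rfl, hx⟩ | ⟨rfl, hx⟩ <;>
        rcases husupp y (hne' y hne.2) with rfl | rfl | ⟨rfl, hy⟩ | ⟨rfl, hy⟩ <;>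
        first
          | exact hself _ hxy
          | exact hst ⟨hx, hy⟩
          | exact hst ⟨hy, hx⟩
          | exact absurd hxy ‹_›
          | exact absurd hxy.symm ‹_›
    have hlam0 : IsLamination (0 : Edge n → ℝ) :=
      ⟨fun _ => le_rfl, fun _ _ => rfl, fun _ _ _ => Or.inl rfl⟩
    have hzero : relevantPart u = 0 := hφ.lamination_unique hn hT hlam hlam0 (by
      rw [hφ.sum_relevantPart, hsum]; simp)
    have hpos : ∀ x, x = g ∨ x = h' → 0 < u x := by
      intro x hx
      have h1 : 1 ≤ (Pi.single g 1 : Edge n → ℝ) x + (Pi.single h' 1 : Edge n → ℝ) x := by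
        rcases hx with rfl | rfl
        · simpa using hsing h' x
        · simpa using hsing g x
      have h2 := mul_nonneg (sub_nonneg.2 hms) (hsing e x)
      have h3 := mul_nonneg (sub_nonneg.2 hmt) (hsing f x)
      simp only [hu, Pi.add_apply, Pi.smul_apply, smul_eq_mul]
      nlinarith
    have hnr : ∀ x, x = g ∨ x = h' → ¬ Relevant x := by
      intro x hx hxr
      have := congrFun hzero x
      rw [relevantPart_of_relevant u hxr] at this
      exact (hpos x hx).ne' this
    exact ⟨hnr g (Or.inl rfl), hnr h' (Or.inr rfl)⟩
  rcases hT.prop.sep_resolution h₁ h₂ h₃ with ⟨hex, hsep⟩ | ⟨hex, hsep⟩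
  · have hsides := main _ _ (facetNormal_add_eq hsep) (by
      simp only [hedef, hfdef, Crosses, Fin.lt_def] at *
      omega)
    have hrot := rotate_vals f
    have hfT : f ∈ T := hT.mem_of_not_crosses fun x hx hc => hex x hx (by
      have := hsides
      simp only [hfdef, hedef, Relevant, Crosses, Fin.lt_def, Fin.le_def] at *
      omega)
    refine ⟨f, Finset.mem_filter.2 ⟨hfT, hf⟩, Or.inr ⟨?_, rfl⟩⟩
    rw [Subtype.ext_iff, Prod.ext_iff, Fin.ext_iff, Fin.ext_iff]
    simp only [hfdef, hedef, Relevant, Fin.lt_def] at *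
    omega
  · have hsides := main _ _ (facetNormal_add_eq hsep) (by
      simp only [hedef, hfdef, Crosses, Fin.lt_def] at *
      omega)
    have hrot := rotate_vals e
    have heT : e ∈ T := hT.mem_of_not_crosses fun x hx hc => hex x hx (by
      have := hsides
      have := x.1.2.2
      simp only [hfdef, hedef, Relevant, Crosses, Fin.lt_def, Fin.le_def] at *
      omega)
    refine ⟨e, Finset.mem_filter.2 ⟨heT, he⟩, Or.inl ⟨rfl, ?_⟩⟩
    rw [Subtype.ext_iff, Prod.ext_iff, Fin.ext_iff, Fin.ext_iff]
    simp only [hfdef, hedef, Relevant, Fin.lt_def] at *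
    omega

theorem IsReduction.parallel_iff (hn : 3 ≤ n) (hT : IsTriangulation T)
    (hφ : IsReduction T φ) {e f : Edge n} (he : Relevant e) (hf : Relevant f) (hne : e ≠ f) :
    (∃ c : ℝ, facetNormal T φ f = c • facetNormal T φ e) ↔
      ∃ δ ∈ diagonals T, (e = δ ∧ f = δ.rotate) ∨ (e = δ.rotate ∧ f = δ) := by
  classical
  constructor
  · rintro ⟨c, hc⟩
    have hsum : ∀ a b : ℝ, ∑ x, (a • Pi.single e 1 + b • Pi.single f 1 : Edge n → ℝ) x
        • facetNormal T φ x = a • facetNormal T φ e + b • facetNormal T φ f := by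
      intro a b
      rw [← proj_sepVec, map_add, map_add, map_smul, map_smul, map_smul, map_smul]
      rfl
    have hlam : ∀ a b : ℝ, 0 ≤ a → 0 ≤ b → (Crosses e f → a = 0 ∨ b = 0) →
        IsLamination (a • Pi.single e 1 + b • Pi.single f 1 : Edge n → ℝ) := by
      intro a b ha hb hab
      have hself : ∀ a : Edge n, ¬ Crosses a a := fun a => by
        simp only [Crosses, Fin.lt_def]; omega
      refine ⟨fun x => ?_, fun x hx => ?_, fun x y hxy => ?_⟩
      · simp only [Pi.add_apply, Pi.smul_apply, smul_eq_mul, Pi.single_apply]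
        split_ifs <;> simp [ha, hb, add_nonneg]
      · have h1 : x ≠ e := fun h => hx (h ▸ he)
        have h2 : x ≠ f := fun h => hx (h ▸ hf)
        simp [h1, h2]
      · by_cases hxe : x = e
        · by_cases hyf : y = f
          · subst hxe hyf
            rcases hab hxy with h | h <;> simp [h, hne, hne.symm]
          · have hye : y ≠ e := by
              rintro rfl
              exact hself _ (hxe ▸ hxy)
            exact Or.inr (by simp [hye, hyf])
        · by_cases hxf : x = f
          · by_cases hye : y = e
            · subst hxf hye
              rcases hab hxy.symm with h | h <;> simp [h, hne, hne.symm]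
            · have hyf : y ≠ f := by
                rintro rfl
                exact hself _ (hxf ▸ hxy)
              exact Or.inr (by simp [hye, hyf])
          · exact Or.inl (by simp [hxe, hxf])
    rcases le_or_gt 0 c with hc0 | hc0
    · have := hφ.lamination_unique hn hT (hlam c 0 hc0 le_rfl fun _ => Or.inr rfl)
        (hlam 0 1 le_rfl zero_le_one fun _ => Or.inl rfl) (by
          rw [hsum, hsum, hc]; simp)
      have := congrFun this f
      simp [hne.symm] at this
    · have hrel : (-c) • facetNormal T φ e + (1 : ℝ) • facetNormal T φ f = 0 := by
        rw [hc]; simp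
      by_cases hef : Crosses e f
      · rcases hef with ⟨h₁, h₂, h₃⟩ | ⟨h₁, h₂, h₃⟩
        · exact hφ.rotate_of_cancel hn hT h₁ h₂ h₃ he hf (neg_pos.2 hc0) one_pos hrel
        · obtain ⟨δ, hδ, h⟩ := hφ.rotate_of_cancel hn hT h₁ h₂ h₃ hf he one_pos (neg_pos.2 hc0)
            (by rw [add_comm]; exact hrel)
          exact ⟨δ, hδ, h.symm.imp And.symm And.symm⟩
      · have := hφ.lamination_unique hn hT
          (hlam (-c) 1 (neg_pos.2 hc0).le zero_le_one fun h => absurd h hef)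
          (hlam 0 0 le_rfl le_rfl fun _ => Or.inl rfl) (by rw [hsum, hsum, hrel]; simp)
        have := congrFun this f
        simp [hne.symm] at this
  · rintro ⟨δ, hδ, ⟨rfl, rfl⟩ | ⟨rfl, rfl⟩⟩
    · exact ⟨-1, by rw [hφ.facetNormal_rotate hT hδ]; simp⟩
    · exact ⟨-1, by rw [hφ.facetNormal_rotate hT hδ]; simp⟩

end

/-! ### Coordinates in the basis of the seed triangulation -/

/-- A diagonal of a triangulation is a diagonal of a quadrilateral whose sides belong to the
triangulation, the union of the two triangles at it. The third vertex of each of the two triangles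
is the neighbour of an end-point that is farthest away from this end-point on its side of the
diagonal. -/
theorem IsTriangulation.exists_quadrilateral {T : Finset (Edge n)} (hT : IsTriangulation T)
    {δ : Edge n} (hδ : δ ∈ diagonals T) :
    ∃ (p q r s : Fin n) (h₁ : p < q) (h₂ : q < r) (h₃ : r < s),
      (⟨(p, q), h₁⟩ : Edge n) ∈ T ∧ (⟨(q, r), h₂⟩ : Edge n) ∈ T ∧ (⟨(r, s), h₃⟩ : Edge n) ∈ T ∧
      (⟨(p, s), h₁.trans (h₂.trans h₃)⟩ : Edge n) ∈ T ∧
      (δ = ⟨(p, r), h₁.trans h₂⟩ ∨ δ = ⟨(q, s), h₂.trans h₃⟩) := by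
  classical
  obtain ⟨hδT, hδr⟩ := Finset.mem_filter.1 hδ
  obtain ⟨⟨a, c⟩, hac⟩ := δ
  obtain ⟨hr1, hr2⟩ : (a : ℕ) + 1 < c ∧ (c : ℕ) + 1 < a + n := hδr
  replace hac : a < c := hac
  have hcn := c.2
  have hnc := fun (e : Edge n) (he : e ∈ T) (f : Edge n) (hf : f ∈ T) => hT.prop e he f hf
  let E : Fin n → Fin n → Prop := fun x y => ∃ h : x < y, (⟨(x, y), h⟩ : Edge n) ∈ T
  have hE : ∀ s ∈ T, E s.1.1 s.1.2 := fun s hs => ⟨s.2, hs⟩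
  -- `b` is the third vertex of the triangle on the side of the vertices between `a` and `c`
  obtain ⟨b, ⟨hb1, hb2, hab, habT⟩, hbmax⟩ : ∃ b : Fin n, (a < b ∧ b < c ∧ E a b) ∧
      ∀ y : Fin n, a < y → y < c → E a y → y ≤ b := by
    obtain ⟨b, hb, hmax⟩ := Finset.exists_max_image
      (Finset.univ.filter fun b : Fin n => a < b ∧ b < c ∧ E a b) id
      ⟨⟨a + 1, by omega⟩, Finset.mem_filter.2 ⟨Finset.mem_univ _,
        Fin.lt_def.2 (Nat.lt_succ_self _), Fin.lt_def.2 hr1, Fin.lt_def.2 (Nat.lt_succ_self _),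
        hT.mem_of_not_relevant (by simp [Relevant])⟩⟩
    exact ⟨b, (Finset.mem_filter.1 hb).2, fun y h1 h2 h3 =>
      hmax y (Finset.mem_filter.2 ⟨Finset.mem_univ y, h1, h2, h3⟩)⟩
  have hbcT : (⟨(b, c), hb2⟩ : Edge n) ∈ T := by
    refine hT.mem_of_not_crosses fun s hs hcr => ?_
    have n1 := hnc _ hδT s hs
    have n2 := hnc _ habT s hs
    have n3 : s.1.1 = a → s.1.2 < c → s.1.2 ≤ b := fun h1 h2 =>
      hbmax s.1.2 (h1 ▸ s.2) h2 (h1 ▸ hE s hs)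
    have hs2 := s.2
    simp only [Crosses, Fin.lt_def, Fin.le_def, Fin.ext_iff] at *
    omega
  -- `d` is the third vertex of the other triangle; `rank d` is the cyclic distance from `c` to `d`
  let rank : Fin n → ℕ := fun d => if c < d then (d : ℕ) - c else (d : ℕ) + n - c
  obtain ⟨d, hd, hdmax⟩ : ∃ d : Fin n, ((c < d ∧ E c d) ∨ (d < a ∧ E d c)) ∧
      ∀ y : Fin n, ((c < y ∧ E c y) ∨ (y < a ∧ E y c)) → rank y ≤ rank d := by
    have hne : (Finset.univ.filter fun d : Fin n =>
        (c < d ∧ E c d) ∨ (d < a ∧ E d c)).Nonempty := by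
      by_cases hc : (c : ℕ) + 1 < n
      · exact ⟨⟨c + 1, hc⟩, Finset.mem_filter.2 ⟨Finset.mem_univ _, Or.inl
          ⟨Fin.lt_def.2 (Nat.lt_succ_self _), Fin.lt_def.2 (Nat.lt_succ_self _),
            hT.mem_of_not_relevant (by simp [Relevant])⟩⟩⟩
      · have ha0 : (⟨0, by omega⟩ : Fin n) < a := Fin.lt_def.2 (show 0 < (a : ℕ) by omega)
        exact ⟨⟨0, by omega⟩, Finset.mem_filter.2 ⟨Finset.mem_univ _, Or.inr
          ⟨ha0, ha0.trans hac, hT.mem_of_not_relevant (by simp only [Relevant]; omega)⟩⟩⟩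
    obtain ⟨d, hd, hmax⟩ := Finset.exists_max_image _ rank hne
    exact ⟨d, (Finset.mem_filter.1 hd).2, fun y hy =>
      hmax y (Finset.mem_filter.2 ⟨Finset.mem_univ y, hy⟩)⟩
  rcases hd with ⟨hcd, hcd', hcdT⟩ | ⟨hda, hdc, hdcT⟩
  · refine ⟨a, b, c, d, hb1, hb2, hcd, habT, hbcT, hcdT, ?_, Or.inl rfl⟩
    refine hT.mem_of_not_crosses fun s hs hcr => ?_
    have n1 := hnc _ hδT s hs
    have n2 := hnc _ hcdT s hs
    have n3 : s.1.1 = c → rank s.1.2 ≤ rank d := fun h1 =>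
      hdmax s.1.2 (Or.inl ⟨h1 ▸ s.2, h1 ▸ hE s hs⟩)
    have n4 : s.1.2 = c → s.1.1 < a → rank s.1.1 ≤ rank d := fun h1 h2 =>
      hdmax s.1.1 (Or.inr ⟨h2, h1 ▸ hE s hs⟩)
    have hs2 := s.2
    have hdn := d.2
    have hsn := s.1.2.2
    simp only [rank, Crosses, Fin.lt_def, Fin.ext_iff] at *
    split_ifs at n3 n4 <;> omega
  · refine ⟨d, a, b, c, hda, hb1, hb2, ?_, habT, hbcT, hdcT, Or.inr rfl⟩
    refine hT.mem_of_not_crosses fun s hs hcr => ?_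
    have n1 := hnc _ hδT s hs
    have n2 := hnc _ hdcT s hs
    have n4 : s.1.2 = c → s.1.1 < a → rank s.1.1 ≤ rank d := fun h1 h2 =>
      hdmax s.1.1 (Or.inr ⟨h2, h1 ▸ hE s hs⟩)
    have hs2 := s.2
    have hsn := s.1.2.2
    simp only [rank, Crosses, Fin.lt_def, Fin.ext_iff] at *
    split_ifs at n4 <;> omega

open scoped Classical in
/-- The shear of a vector at a quadrilateral, the difference of the weights of its two pairs of
opposite sides, counts with signs the edges that join opposite arcs. -/
theorem shear_sepVec (w : Edge n → ℝ) {p q r s : Fin n} (h₁ : p < q) (h₂ : q < r) (h₃ : r < s) :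
    (sepVec n w ⟨(p, q), h₁⟩ + sepVec n w ⟨(r, s), h₃⟩)
      - (sepVec n w ⟨(p, s), h₁.trans (h₂.trans h₃)⟩ + sepVec n w ⟨(q, r), h₂⟩)
      = ∑ e, w e * ((if JoinsLeft p q r s e then 2 else 0)
        - if JoinsRight p q r s e then 2 else 0) := by
  simp only [mul_sub, Finset.sum_sub_distrib]
  rw [← sepVec_add_sub_left w h₁ h₂ h₃, ← sepVec_add_sub_right w h₁ h₂ h₃]
  ring

/-- No edge joins both pairs of opposite arcs. -/
theorem not_joinsLeft_and_joinsRight {p q r s : Fin n} {e : Edge n} :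
    ¬ (JoinsLeft p q r s e ∧ JoinsRight p q r s e) := by
  rintro ⟨h1, h2⟩
  have := h1.crosses h2
  simp only [Crosses, Fin.lt_def] at this
  omega

theorem eq_of_joinsLeft {p q r s : Fin n} (h₁ : p < q) (h₂ : q < r) (h₃ : r < s) {e : Edge n}
    (he : JoinsLeft p q r s e) (hpq : ¬ Crosses ⟨(p, q), h₁⟩ e) (hrs : ¬ Crosses ⟨(r, s), h₃⟩ e) :
    e = ⟨(p, r), h₁.trans h₂⟩ := by
  rw [Subtype.ext_iff, Prod.ext_iff, Fin.ext_iff, Fin.ext_iff]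
  simp only [JoinsLeft, Crosses, Fin.lt_def, Fin.le_def] at *
  omega

theorem eq_of_joinsRight {p q r s : Fin n} (h₁ : p < q) (h₂ : q < r) (h₃ : r < s) {e : Edge n}
    (he : JoinsRight p q r s e) (hqr : ¬ Crosses ⟨(q, r), h₂⟩ e)
    (hps : ¬ Crosses ⟨(p, s), h₁.trans (h₂.trans h₃)⟩ e) : e = ⟨(q, s), h₂.trans h₃⟩ := by
  rw [Subtype.ext_iff, Prod.ext_iff, Fin.ext_iff, Fin.ext_iff]
  have := e.2
  simp only [JoinsRight, Crosses, Fin.lt_def, Fin.le_def] at *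
  omega

section

variable {T : Finset (Edge n)} {φ : (T → ℝ) →ₗ[ℝ] (diagonals T → ℝ)}

/-- Half the shears at the quadrilaterals of the seed triangulation are, up to signs, the dual
basis of its facet normals, and their values on the generators are `0`, `1` and `-1`. -/
theorem IsReduction.exists_coordinates (hn : 3 ≤ n) (hT : IsTriangulation T)
    (hφ : IsReduction T φ) (e : Edge n) :
    ∃ c : diagonals T → ℝ, (∀ δ, c δ = 0 ∨ c δ = 1 ∨ c δ = -1) ∧
      facetNormal T φ e = ∑ δ, c δ • facetNormal T φ δ.1 := by
  classical
  obtain ⟨ω, hω, hsum⟩ := hφ.exists_sum_eq hn hT hT (facetNormal T φ e)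
  refine ⟨fun δ => ω δ.1, ?_, ?_⟩
  swap
  · rw [← hsum, Finset.sum_coe_sort (diagonals T) fun δ => ω δ • facetNormal T φ δ]
    exact (Finset.sum_subset (Finset.subset_univ _) fun δ _ hδ => by simp [hω δ hδ]).symm
  rintro ⟨δ, hδ⟩
  have hδT := (Finset.mem_filter.1 hδ).1
  have hnc := fun (e : Edge n) (he : e ∈ T) (f : Edge n) (hf : f ∈ T) => hT.prop e he f hf
  obtain ⟨p, q, r, s, h₁, h₂, h₃, hpq, hqr, hrs, hps, hcase⟩ := hT.exists_quadrilateral hδ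
  set J : Edge n → ℝ := fun f => (if JoinsLeft p q r s f then 2 else 0)
    - if JoinsRight p q r s f then 2 else 0 with hJ
  -- the shear vanishes on `u`, hence on the relation between `e` and the basis
  have hshear : ∑ f, (Pi.single e 1 - ω : Edge n → ℝ) f * J f = 0 := by
    have hproj : proj T φ (sepVec n (Pi.single e 1 - ω)) = 0 := by
      rw [map_sub, map_sub, proj_sepVec ω, hsum]
      exact sub_self _
    obtain ⟨u, hu, huT⟩ := hφ.proj_eq_zero_iff.1 hproj
    have hu' : ∀ f ∈ T, sepVec n (Pi.single e 1 - ω) f = u f := fun f hf =>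
      (congrFun huT ⟨f, hf⟩).symm
    obtain ⟨x, hx, rfl⟩ := mem_irrelevantSpace_iff.1 hu
    rw [← shear_sepVec _ h₁ h₂ h₃, hu' _ hpq, hu' _ hqr, hu' _ hrs, hu' _ hps,
      shear_sepVec _ h₁ h₂ h₃]
    refine Finset.sum_eq_zero fun f _ => ?_
    by_cases hf : Relevant f
    · rw [hx f hf, zero_mul]
    · rw [if_neg fun h => hf (JoinsLeft.relevant h₂ h),
        if_neg fun h => hf (JoinsRight.relevant h₁ h₃ h), sub_self, mul_zero]
  have hJe : J e = 0 ∨ J e = 2 ∨ J e = -2 := by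
    have := not_joinsLeft_and_joinsRight (p := p) (q := q) (r := r) (s := s) (e := e)
    simp only [hJ]
    split_ifs <;> simp_all
  have hJδ : J δ = 2 ∨ J δ = -2 := by
    rcases hcase with rfl | rfl
    · left
      have h1 : JoinsLeft p q r s ⟨(p, r), h₁.trans h₂⟩ := ⟨⟨le_rfl, h₁⟩, le_rfl, h₃⟩
      simp only [hJ, if_pos h1, if_neg fun h2 => not_joinsLeft_and_joinsRight ⟨h1, h2⟩, sub_zero]
    · right
      have h1 : JoinsRight p q r s ⟨(q, s), h₂.trans h₃⟩ := Or.inr ⟨le_rfl, h₂, le_rfl⟩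
      simp only [hJ, if_pos h1, if_neg fun h2 => not_joinsLeft_and_joinsRight ⟨h2, h1⟩, zero_sub]
  have hJ0 : ∀ f ∈ T, f ≠ δ → J f = 0 := by
    intro f hf hne
    have hcross : Crosses (⟨(p, r), h₁.trans h₂⟩ : Edge n) ⟨(q, s), h₂.trans h₃⟩ :=
      Or.inl ⟨h₁, h₂, h₃⟩
    have hL : ¬ JoinsLeft p q r s f := by
      intro h
      have hf' := eq_of_joinsLeft h₁ h₂ h₃ h (hnc _ hpq _ hf) (hnc _ hrs _ hf)
      rcases hcase with h' | h'
      · exact hne (hf'.trans h'.symm)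
      · exact hnc _ hf _ hδT (hf' ▸ h' ▸ hcross)
    have hR : ¬ JoinsRight p q r s f := by
      intro h
      have hf' := eq_of_joinsRight h₁ h₂ h₃ h (hnc _ hqr _ hf) (hnc _ hps _ hf)
      rcases hcase with h' | h'
      · exact hnc _ hδT _ hf (hf' ▸ h' ▸ hcross)
      · exact hne (hf'.trans h'.symm)
    simp only [hJ, if_neg hL, if_neg hR, sub_self]
  have hωJ : ∑ f, ω f * J f = ω δ * J δ := by
    refine Finset.sum_eq_single δ (fun f _ hne => ?_) fun h => absurd (Finset.mem_univ δ) h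
    by_cases hf : f ∈ diagonals T
    · rw [hJ0 f (Finset.mem_filter.1 hf).1 hne, mul_zero]
    · rw [hω f hf, zero_mul]
  simp only [Pi.sub_apply, sub_mul, Finset.sum_sub_distrib, hωJ, Pi.single_apply, ite_mul, one_mul,
    zero_mul, Finset.sum_ite_eq', Finset.mem_univ, if_true] at hshear
  change ω δ = 0 ∨ ω δ = 1 ∨ ω δ = -1
  rcases hJδ with h | h <;> rcases hJe with h' | h' | h' <;> rw [h, h'] at hshear
  · left; linarith
  · right; left; linarith
  · right; right; linarith
  · left; linarith
  · right; right; linarith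
  · right; left; linarith

end

end Assoc

theorem mainTheorem8 (n : ℕ) (hn : 3 ≤ n) (T : Finset (Assoc.Edge n))
    (hT : Assoc.IsTriangulation T) :
    -- the target space has dimension `n - 3`, and the second projection exists
    (Assoc.diagonals T).card + 3 = n ∧
    (∃ φ : (T → ℝ) →ₗ[ℝ] (Assoc.diagonals T → ℝ), Assoc.IsReduction T φ) ∧
    ∀ φ : (T → ℝ) →ₗ[ℝ] (Assoc.diagonals T → ℝ), Assoc.IsReduction T φ →
      -- the composed projection is injective on the fan, modulo the irrelevant face
      ⋃₀ Assoc.fanPVplus n = Assoc.PVplus n ∧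
      (∀ v ∈ Assoc.PVplus n, ∀ v' ∈ Assoc.PVplus n,
        Assoc.proj T φ v = Assoc.proj T φ v' ↔ v - v' ∈ Assoc.irrelevantSpace n) ∧
      -- the projected fan is the normal fan of a polytope realizing the associahedron
      Assoc.RealizesAssociahedron (Assoc.facetNormal T φ) Assoc.rhs ∧
      Assoc.normalFan (Assoc.polyhedron (Assoc.facetNormal T φ) Assoc.rhs)
        = Assoc.projectedFan T φ ∧
      (∀ G ∈ Assoc.reducedComplex n,
        Assoc.normalCone (Assoc.polyhedron (Assoc.facetNormal T φ) Assoc.rhs)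
            (Assoc.faceOf (Assoc.facetNormal T φ) Assoc.rhs G)
          = Assoc.proj T φ '' Assoc.coneOf G) ∧
      -- the right-hand sides satisfy the wall-crossing inequalities
      Assoc.WallCrossing (Assoc.facetNormal T φ) Assoc.rhs ∧
      -- the pairs of parallel facets
      (∀ δ ∈ Assoc.diagonals T, Assoc.Relevant δ.rotate ∧
        Assoc.facetNormal T φ δ.rotate = -Assoc.facetNormal T φ δ) ∧
      (∀ e f : Assoc.Edge n, Assoc.Relevant e → Assoc.Relevant f → e ≠ f →
        ((∃ c : ℝ, Assoc.facetNormal T φ f = c • Assoc.facetNormal T φ e) ↔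
          ∃ δ ∈ Assoc.diagonals T, (e = δ ∧ f = δ.rotate) ∨ (e = δ.rotate ∧ f = δ))) ∧
      (∀ δ ∈ Assoc.diagonals T, ∀ δ' ∈ Assoc.diagonals T,
        ({δ, δ.rotate} : Set (Assoc.Edge n)) = {δ', δ'.rotate} → δ = δ') ∧
      -- a basis in which all facet normals have coordinates in `{0, 1, -1}`
      LinearIndependent ℝ (fun δ : Assoc.diagonals T => Assoc.facetNormal T φ δ.1) ∧
      Submodule.span ℝ
        (Set.range fun δ : Assoc.diagonals T => Assoc.facetNormal T φ δ.1) = ⊤ ∧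
      (∀ e : Assoc.Edge n, Assoc.Relevant e →
        ∃ c : Assoc.diagonals T → ℝ, (∀ δ, c δ = 0 ∨ c δ = 1 ∨ c δ = -1) ∧
          Assoc.facetNormal T φ e = ∑ δ, c δ • Assoc.facetNormal T φ δ.1) := by
  refine ⟨hT.card_diagonals hn, hT.exists_isReduction hn, fun φ hφ =>
    ⟨Assoc.sUnion_fanPVplus hn, fun v hv v' hv' => hφ.proj_eq_iff hn hT hv hv',
      hφ.realizesAssociahedron hn hT, hφ.normalFan_eq hn hT,
      fun G hG => hφ.normalCone_faceOf hn hT hG, hφ.wallCrossing hn hT,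
      fun δ hδ => ⟨(Finset.mem_filter.1 hδ).2.rotate, hφ.facetNormal_rotate hT hδ⟩,
      fun e f he hf hne => hφ.parallel_iff hn hT he hf hne,
      fun δ hδ δ' hδ' h => hT.eq_of_pair_rotate_eq hδ hδ' h,
      hφ.linearIndepOn hn hT hT.diagonals_mem, hφ.span_eq_top hn hT hT,
      fun e _ => hφ.exists_coordinates hn hT e⟩⟩
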